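/- Let $n\ge 0$ and $r\ge 0$ be integers, let $\mathrm{Sym}^2(\mathbb R^n)$ be the space of real symmetric $n\times n$ matrices and let $\mathcal S(r;n)\subset \mathrm{Sym}^2(\mathbb R^n)$ be the smooth manifold of symmetric matrices of rank exactly $r$. Let $T\in \mathrm{Sym}^2(\mathbb R^n)$ have full rank $n$ and distinct eigenvalues $\sigma_1,\dots,\sigma_n$, and let $T=U\,\mathrm{diag}(\sigma_1,\dots,\sigma_n)\,U^{\top}$, with $U$ orthogonal, be an eigendecomposition of $T$. Put $$h_T(S)=2\langle S-T,S-T\rangle_F+\mathrm{tr}(S-T)^2 ,\qquad \langle A,B\rangle_F=\mathrm{tr}(A^{\top}B).$$ For $I\subseteq\{1,\dots,n\}$ with $\#I=r$ put $I^c=\{1,\dots,n\}\setminus I$ and $$c_I=\frac{\sum_{j\in I^c}\sigma_j}{r+2},\qquad S_I=U\Lambda_IU^{\top},$$ where $\Lambda_I$ is the diagonal matrix with $i$-th diagonal entry $\sigma_i+c_I$ if $i\in I$ and $0$ if $i\notin I$. Call $I$ admissible if $\sigma_i+c_I\neq 0$ for all $i\in I$, i.e. if $S_I$ has rank $r$.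 1. The critical points of the restriction $h_T|_{\mathcal S(r;n)}$ are exactly the matrices $S_I$ with $I\subseteq\{1,\dots,n\}$, $\#I=r$, $I$ admissible, and distinct admissible $I$ give distinct $S_I$. In particular, if every $I$ with $\#I=r$ is admissible, then $h_T|_{\mathcal S(r;n)}$ has exactly $\binom nr$ critical points. 2. For every admissible $I$ with $\#I=r$, the index of $h_T|_{\mathcal S(r;n)}$ at $S_I$ (the number of negative eigenvalues, with multiplicity, of the Hessian of $h_T$ in any local parametrization of $\mathcal S(r;n)$ around $S_I$) is $$\#\Bigl\{(i,j)\in I\times I^c:\ 0\le\frac{\sigma_i+c_I}{\sigma_j+c_I}\le 1\Bigr\},$$ where pairs with $\sigma_j+c_I=0$ are not counted. -/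

import Mathlib

open Set Topology Matrix
open scoped ContDiff

attribute [local instance] Matrix.normedAddCommGroup Matrix.normedSpace

noncomputable section

/-- `p : U → X` is a smooth local parametrization (inverse chart) of the subset `X` of a normed
space, centred at `s`: `U ⊆ ℝ^d` is an open neighbourhood of `0`, `p 0 = s`, and `p` is a smooth
injective immersion which maps open subsets of `U` to relatively open subsets of `X` (so `p` is a
homeomorphism of `U` onto a relatively open neighbourhood of `s` in `X`). -/
structure IsLocalParam {V : Type*} [NormedAddCommGroup V] [NormedSpace ℝ V]
    (X : Set V) (s : V) {d : ℕ} (U : Set (EuclideanSpace ℝ (Fin d)))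
    (p : EuclideanSpace ℝ (Fin d) → V) : Prop where
  isOpen : IsOpen U
  zero_mem : 0 ∈ U
  map_zero : p 0 = s
  contDiffOn : ContDiffOn ℝ ∞ p U
  injOn : InjOn p U
  immersion : ∀ u ∈ U, Function.Injective (fderiv ℝ p u)
  image_open : ∀ W ⊆ U, IsOpen W → ∃ O : Set V, IsOpen O ∧ p '' W = O ∩ X

/-- `X` is a smooth embedded submanifold near its point `s`. -/
def IsSmoothPoint {V : Type*} [NormedAddCommGroup V] [NormedSpace ℝ V]
    (X : Set V) (s : V) : Prop :=
  ∃ (d : ℕ) (U : Set (EuclideanSpace ℝ (Fin d))) (p : EuclideanSpace ℝ (Fin d) → V),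
    IsLocalParam X s U p

/-- The tangent vectors to `X` at `s`: velocities at `s` of smooth curves lying in `X`. -/
def tangentVectors {V : Type*} [NormedAddCommGroup V] [NormedSpace ℝ V]
    (X : Set V) (s : V) : Set V :=
  {v | ∃ γ : ℝ → V, γ 0 = s ∧ ContDiffAt ℝ ∞ γ 0 ∧ (∀ᶠ t in 𝓝 (0 : ℝ), γ t ∈ X) ∧
    deriv γ 0 = v}

/-- The critical points of the restriction of `f` to `X`: the smooth points `s` of `X` at which
the differential of `f` vanishes in all directions tangent to `X`. -/
def criticalPointsOn {V : Type*} [NormedAddCommGroup V] [NormedSpace ℝ V]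
    (f : V → ℝ) (X : Set V) : Set V :=
  {s | s ∈ X ∧ IsSmoothPoint X s ∧ ∀ v ∈ tangentVectors X s, fderiv ℝ f s v = 0}

/-- The Hessian matrix at `0` of a function on `ℝ^d`. -/
def hessianAtZero {d : ℕ} (g : EuclideanSpace ℝ (Fin d) → ℝ) : Matrix (Fin d) (Fin d) ℝ :=
  Matrix.of fun i j =>
    fderiv ℝ (fderiv ℝ g) 0 (EuclideanSpace.single i 1) (EuclideanSpace.single j 1)

open Classical in
/-- The number of negative eigenvalues of a real square matrix, counted with multiplicity. -/
def numNegEigenvalues {d : ℕ} (H : Matrix (Fin d) (Fin d) ℝ) : ℕ :=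
  (H.charpoly.roots.filter (fun x => x < 0)).card

/-- The restriction of `f` to `X` has index `k` at the (critical) point `s`: `X` admits a local
parametrization centred at `s`, and for every such parametrization `p` the Hessian matrix
`H(f ∘ p)(0)` has exactly `k` negative eigenvalues. -/
def HasIndexOn {V : Type*} [NormedAddCommGroup V] [NormedSpace ℝ V]
    (f : V → ℝ) (X : Set V) (s : V) (k : ℕ) : Prop :=
  IsSmoothPoint X s ∧
  ∀ (d : ℕ) (U : Set (EuclideanSpace ℝ (Fin d))) (p : EuclideanSpace ℝ (Fin d) → V),
    IsLocalParam X s U p → numNegEigenvalues (hessianAtZero (f ∘ p)) = k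

/-- The set of symmetric `n × n` real matrices of rank exactly `r`. -/
def symRank (n r : ℕ) : Set (Matrix (Fin n) (Fin n) ℝ) :=
  {S | S.IsSymm ∧ S.rank = r}

/-- The squared distance to `T` in the Gaussian norm,
`h_T(S) = 2⟨S - T, S - T⟩_F + tr(S - T)²`, where `⟨A, B⟩_F = tr(Aᵀ B)`. -/
def gaussianLoss {n : ℕ} (T S : Matrix (Fin n) (Fin n) ℝ) : ℝ :=
  2 * ((S - T)ᵀ * (S - T)).trace + (S - T).trace ^ 2

/-- The shift `c_I = (∑_{j ∉ I} σ_j) / (r + 2)` with `r = #I`. -/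
def eigShift {n : ℕ} (σ : Fin n → ℝ) (I : Finset (Fin n)) : ℝ :=
  (∑ j ∈ Iᶜ, σ j) / ((I.card : ℝ) + 2)

/-- The matrix `S_I = U Λ_I Uᵀ`, where `Λ_I` is diagonal with entries `σ_i + c_I` for `i ∈ I` and
`0` for `i ∉ I`. -/
def critMatrix {n : ℕ} (U : Matrix (Fin n) (Fin n) ℝ) (σ : Fin n → ℝ) (I : Finset (Fin n)) :
    Matrix (Fin n) (Fin n) ℝ :=
  U * Matrix.diagonal (fun i => if i ∈ I then σ i + eigShift σ I else 0) * Uᵀ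

/-- The `r`-element index sets `I` for which no shifted eigenvalue `σ_i + c_I`, `i ∈ I`, is zero,
i.e. for which `S_I` has rank `r`. -/
def admissibleSets {n : ℕ} (σ : Fin n → ℝ) (r : ℕ) : Set (Finset (Fin n)) :=
  {I | I.card = r ∧ ∀ i ∈ I, σ i + eigShift σ I ≠ 0}

/-- The pairs `(i, j) ∈ I × Iᶜ` such that the quotient `(σ_i + c_I) / (σ_j + c_I)` is defined and
lies in `[0, 1]`. -/
def indexPairs {n : ℕ} (σ : Fin n → ℝ) (I : Finset (Fin n)) : Set (Fin n × Fin n) :=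
  {q | q.1 ∈ I ∧ q.2 ∈ Iᶜ ∧ σ q.2 + eigShift σ I ≠ 0 ∧
    0 ≤ (σ q.1 + eigShift σ I) / (σ q.2 + eigShift σ I) ∧
    (σ q.1 + eigShift σ I) / (σ q.2 + eigShift σ I) ≤ 1}

end

/-! Conjugation by `U` preserves the rank, the symmetry and the loss, so `T` may be taken to be
`diagonal σ`.

Critical points: the curves `(1 + tA) S (1 + tA)ᵀ` stay in the rank stratum. With `G = 2(S - T) +
tr(S - T)`, half the gradient of the loss, the choice `A = (SG)ᵀ` turns criticality into `‖SG‖² = 0`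
(`mul_gradient_eq_zero`). Hence `S` commutes with `diagonal σ` and is diagonal, because the `σ i`
are distinct. Its nonzero entries are `σ i - tr(S - T)/2`, and taking the trace forces the shift to
be `c_I` (`exists_diagOn_of_critical`). Conversely, at such a matrix the differential involves only
the diagonal entries in the complementary block, while tangent vectors vanish on that block
(`deriv_mem_borderedSpace`).

Index: near `diagOn I l` a matrix of rank `#I` is determined by its rows and columns in `I`, its
complementary block being a Schur complement. Along a curve with velocity `v` that block is
therefore `t²` times the corresponding block of `v Λ⁻¹ v`, up to `o(t²)`, where `Λ⁻¹` inverts the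
`I`-block and is zero elsewhere. Feeding this into the quadratic polynomial `gaussianLoss` gives
`lossForm`. With `λ = shifted σ I`, it is a sum of squares plus the terms `4 (1 - λ j / λ i) v i j ^
2` for `i ∈ I`, `j ∉ I` (`lossForm_eq`). The negative coefficients sit exactly at `indexPairs`, and
Sylvester's law (`numNegEigenvalues_eq_of_forms`) counts them. For an arbitrary parametrization this
needs its differential at `0` to fill the whole tangent space, which is the dimension bound
`finrank_borderedSpace_le`. -/

noncomputable section

/-! ### Symmetric matrices of given rank with an invertible principal block -/

section CornerAlgebra

variable {n : ℕ}

/-- The coordinate projection onto the coordinates in `I`. -/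
def coordProj (I : Finset (Fin n)) : Matrix (Fin n) (Fin n) ℝ :=
  Matrix.diagonal fun i => if i ∈ I then 1 else 0

lemma coordProj_mul_self (I : Finset (Fin n)) : coordProj I * coordProj I = coordProj I := by
  simp [coordProj, Matrix.diagonal_mul_diagonal]

lemma coordProj_transpose (I : Finset (Fin n)) : (coordProj I)ᵀ = coordProj I := by
  simp [coordProj]

lemma rank_coordProj (I : Finset (Fin n)) : (coordProj I).rank = I.card := by
  rw [coordProj, Matrix.rank_diagonal]
  simp

/-- The principal `I`-block of `S`, completed to an `n × n` matrix by the identity on the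
complementary coordinates. -/
def paddedBlock (I : Finset (Fin n)) (S : Matrix (Fin n) (Fin n) ℝ) :
    Matrix (Fin n) (Fin n) ℝ :=
  coordProj I * S * coordProj I + (1 - coordProj I)

/-- The inverse of the principal `I`-block of `S`, extended by zero. -/
def blockInv (I : Finset (Fin n)) (S : Matrix (Fin n) (Fin n) ℝ) :
    Matrix (Fin n) (Fin n) ℝ :=
  coordProj I * (paddedBlock I S)⁻¹ * coordProj I

/-- The matrix obtained from `S` by setting the entries in the complementary principal block of
`I` to zero. -/
def dropBlock (I : Finset (Fin n)) (S : Matrix (Fin n) (Fin n) ℝ) :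
    Matrix (Fin n) (Fin n) ℝ :=
  S - (1 - coordProj I) * S * (1 - coordProj I)

/-- The completion of a symmetric matrix `F` with zero complementary block to a matrix of rank
`#I`. -/
def rankCompletion (I : Finset (Fin n)) (F : Matrix (Fin n) (Fin n) ℝ) :
    Matrix (Fin n) (Fin n) ℝ :=
  F * blockInv I F * F

variable {I : Finset (Fin n)} {S F : Matrix (Fin n) (Fin n) ℝ}

lemma coordProj_mul_compl : coordProj I * (1 - coordProj I) = 0 := by
  rw [mul_sub, coordProj_mul_self, mul_one, sub_self]

lemma compl_mul_coordProj : (1 - coordProj I) * coordProj I = 0 := by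
  rw [sub_mul, coordProj_mul_self, one_mul, sub_self]

lemma coordProj_mul_paddedBlock :
    coordProj I * paddedBlock I S = coordProj I * S * coordProj I := by
  rw [paddedBlock, mul_add, coordProj_mul_compl, ← mul_assoc, ← mul_assoc, coordProj_mul_self,
    add_zero]

lemma paddedBlock_mul_coordProj :
    paddedBlock I S * coordProj I = coordProj I * S * coordProj I := by
  rw [paddedBlock, add_mul, compl_mul_coordProj, mul_assoc _ (coordProj I), coordProj_mul_self,
    add_zero]

lemma isUnit_det_of_ne (h : (paddedBlock I S).det ≠ 0) : IsUnit (paddedBlock I S).det :=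
  isUnit_iff_ne_zero.2 h

/-- The padded block is block diagonal, so it commutes with the projection, and hence so does its
inverse. -/
lemma coordProj_mul_inv (h : (paddedBlock I S).det ≠ 0) :
    coordProj I * (paddedBlock I S)⁻¹ = (paddedBlock I S)⁻¹ * coordProj I := by
  have hu := isUnit_det_of_ne h
  calc coordProj I * (paddedBlock I S)⁻¹
      = (paddedBlock I S)⁻¹ * (paddedBlock I S * coordProj I) * (paddedBlock I S)⁻¹ := by
        rw [← mul_assoc, Matrix.nonsing_inv_mul _ hu, one_mul]
    _ = (paddedBlock I S)⁻¹ * (coordProj I * paddedBlock I S) * (paddedBlock I S)⁻¹ := by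
        rw [paddedBlock_mul_coordProj, coordProj_mul_paddedBlock]
    _ = (paddedBlock I S)⁻¹ * coordProj I := by
        rw [mul_assoc, mul_assoc, Matrix.mul_nonsing_inv _ hu, mul_one]

lemma blockInv_eq (h : (paddedBlock I S).det ≠ 0) :
    blockInv I S = (paddedBlock I S)⁻¹ * coordProj I := by
  rw [blockInv, coordProj_mul_inv h, mul_assoc, coordProj_mul_self]

lemma blockInv_eq' (h : (paddedBlock I S).det ≠ 0) :
    blockInv I S = coordProj I * (paddedBlock I S)⁻¹ := by
  rw [blockInv_eq h, coordProj_mul_inv h]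

lemma blockInv_mul_coordProj : blockInv I S * coordProj I = blockInv I S := by
  rw [blockInv, mul_assoc, coordProj_mul_self]

lemma coordProj_mul_blockInv : coordProj I * blockInv I S = blockInv I S := by
  rw [blockInv, ← mul_assoc, ← mul_assoc, coordProj_mul_self]

lemma blockInv_mul_mul_coordProj (h : (paddedBlock I S).det ≠ 0) :
    blockInv I S * S * coordProj I = coordProj I := by
  calc blockInv I S * S * coordProj I
      = (paddedBlock I S)⁻¹ * (coordProj I * S * coordProj I) := by
        rw [blockInv_eq h]; simp only [mul_assoc]
    _ = coordProj I := by
        rw [← paddedBlock_mul_coordProj, ← mul_assoc,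
          Matrix.nonsing_inv_mul _ (isUnit_det_of_ne h), one_mul]

lemma coordProj_mul_mul_blockInv (h : (paddedBlock I S).det ≠ 0) :
    coordProj I * S * blockInv I S = coordProj I := by
  calc coordProj I * S * blockInv I S
      = (coordProj I * S * coordProj I) * (paddedBlock I S)⁻¹ := by
        rw [blockInv_eq' h]; simp only [mul_assoc]
    _ = coordProj I := by
        rw [← coordProj_mul_paddedBlock, mul_assoc,
          Matrix.mul_nonsing_inv _ (isUnit_det_of_ne h), mul_one]

lemma blockInv_mul_mul_blockInv (h : (paddedBlock I S).det ≠ 0) :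
    blockInv I S * S * blockInv I S = blockInv I S := by
  calc blockInv I S * S * blockInv I S
      = blockInv I S * S * coordProj I * blockInv I S := by
        rw [mul_assoc _ (coordProj I), coordProj_mul_blockInv]
    _ = blockInv I S := by rw [blockInv_mul_mul_coordProj h, coordProj_mul_blockInv]

lemma blockInv_transpose (hS : S.IsSymm) : (blockInv I S)ᵀ = blockInv I S := by
  have hC : (paddedBlock I S)ᵀ = paddedBlock I S := by
    simp [paddedBlock, Matrix.transpose_mul, coordProj_transpose, hS.eq, mul_assoc]
  rw [blockInv, Matrix.transpose_mul, Matrix.transpose_mul, Matrix.transpose_nonsing_inv, hC,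
    coordProj_transpose, mul_assoc]

/-- The principal block of a matrix has rank at most the rank of the matrix, so an invertible
principal block bounds the rank from below. -/
lemma card_le_rank (h : (paddedBlock I S).det ≠ 0) : I.card ≤ S.rank := by
  calc I.card = (coordProj I).rank := (rank_coordProj I).symm
    _ = (blockInv I S * S * coordProj I).rank := by rw [blockInv_mul_mul_coordProj h]
    _ ≤ (blockInv I S * S).rank := Matrix.rank_mul_le_left _ _
    _ ≤ S.rank := Matrix.rank_mul_le_right _ _

/-- A matrix with an invertible principal block of size equal to its rank is determined by the
corresponding rows and columns. -/
lemma mul_blockInv_mul_self_of_rank (h : (paddedBlock I S).det ≠ 0) (hr : S.rank = I.card) :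
    S * blockInv I S * S = S := by
  -- The columns of `S` indexed by `I` already span its range, so it suffices to check the identity
  -- on vectors `S *ᵥ x` of the form `S * coordProj I *ᵥ z`.
  have hle : LinearMap.range (S * coordProj I).mulVecLin ≤ LinearMap.range S.mulVecLin := by
    rw [Matrix.mulVecLin_mul]
    exact LinearMap.range_comp_le_range _ _
  have hrank : (S * coordProj I).rank = S.rank := by
    apply le_antisymm (Matrix.rank_mul_le_left _ _)
    rw [hr, ← rank_coordProj I]
    calc (coordProj I).rank = (blockInv I S * (S * coordProj I)).rank := by
          rw [← mul_assoc, blockInv_mul_mul_coordProj h]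
      _ ≤ _ := Matrix.rank_mul_le_right _ _
  have hrange := Submodule.eq_of_le_of_finrank_eq hle hrank
  have key : ∀ x, (S * blockInv I S * S) *ᵥ x = S *ᵥ x := by
    intro x
    have hx : S *ᵥ x ∈ LinearMap.range (S * coordProj I).mulVecLin := by
      rw [hrange]; exact ⟨x, rfl⟩
    obtain ⟨z, hz⟩ := hx
    rw [Matrix.mulVecLin_apply] at hz
    rw [← Matrix.mulVec_mulVec, ← hz, Matrix.mulVec_mulVec]
    congr 1
    rw [mul_assoc, ← mul_assoc (blockInv I S), blockInv_mul_mul_coordProj h]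
  exact Matrix.ext_of_mulVec_single fun i => key _

lemma rank_of_mul_blockInv_mul_self (h : (paddedBlock I S).det ≠ 0)
    (hS : S * blockInv I S * S = S) : S.rank = I.card := by
  refine le_antisymm ?_ (card_le_rank h)
  calc S.rank = (S * blockInv I S * S).rank := by rw [hS]
    _ ≤ (S * blockInv I S).rank := Matrix.rank_mul_le_left _ _
    _ ≤ (blockInv I S).rank := Matrix.rank_mul_le_right _ _
    _ ≤ (coordProj I).rank := Matrix.rank_mul_le_right _ _
    _ = I.card := rank_coordProj I

lemma coordProj_mul_dropBlock : coordProj I * dropBlock I S = coordProj I * S := by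
  rw [dropBlock, mul_sub, ← mul_assoc, ← mul_assoc, coordProj_mul_compl, zero_mul, zero_mul,
    sub_zero]

lemma dropBlock_mul_coordProj : dropBlock I S * coordProj I = S * coordProj I := by
  rw [dropBlock, sub_mul, mul_assoc, compl_mul_coordProj, mul_zero, sub_zero]

lemma paddedBlock_dropBlock : paddedBlock I (dropBlock I S) = paddedBlock I S := by
  rw [paddedBlock, coordProj_mul_dropBlock, paddedBlock]

lemma blockInv_dropBlock : blockInv I (dropBlock I S) = blockInv I S := by
  rw [blockInv, paddedBlock_dropBlock, blockInv]

/-- A matrix of rank `#I` with invertible principal `I`-block is the completion of its part outside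
the complementary block. -/
lemma rankCompletion_dropBlock (h : (paddedBlock I S).det ≠ 0) (hr : S.rank = I.card) :
    rankCompletion I (dropBlock I S) = S := by
  rw [rankCompletion, blockInv_dropBlock]
  calc dropBlock I S * blockInv I S * dropBlock I S
      = dropBlock I S * coordProj I * blockInv I S * (coordProj I * dropBlock I S) := by
        rw [mul_assoc _ (coordProj I), coordProj_mul_blockInv, ← mul_assoc, mul_assoc _ _
          (coordProj I), blockInv_mul_coordProj]
    _ = S * blockInv I S * S := by
        rw [dropBlock_mul_coordProj, coordProj_mul_dropBlock, mul_assoc S,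
          coordProj_mul_blockInv, ← mul_assoc, mul_assoc S, blockInv_mul_coordProj]
    _ = S := mul_blockInv_mul_self_of_rank h hr

lemma coordProj_mul_rankCompletion (h : (paddedBlock I F).det ≠ 0) :
    coordProj I * rankCompletion I F = coordProj I * F := by
  rw [rankCompletion, ← mul_assoc, ← mul_assoc, coordProj_mul_mul_blockInv h]

lemma rankCompletion_mul_coordProj (h : (paddedBlock I F).det ≠ 0) :
    rankCompletion I F * coordProj I = F * coordProj I := by
  rw [rankCompletion, mul_assoc, mul_assoc, ← mul_assoc (blockInv I F),
    blockInv_mul_mul_coordProj h]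

lemma paddedBlock_rankCompletion (h : (paddedBlock I F).det ≠ 0) :
    paddedBlock I (rankCompletion I F) = paddedBlock I F := by
  rw [paddedBlock, coordProj_mul_rankCompletion h, paddedBlock]

/-- This form uses only the rows and columns in `I`, which `rankCompletion` leaves unchanged. -/
lemma dropBlock_eq (S : Matrix (Fin n) (Fin n) ℝ) :
    dropBlock I S = coordProj I * S + S * coordProj I - coordProj I * S * coordProj I := by
  rw [dropBlock]; noncomm_ring

lemma dropBlock_rankCompletion (h : (paddedBlock I F).det ≠ 0) (hF : dropBlock I F = F) :
    dropBlock I (rankCompletion I F) = F := by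
  rw [dropBlock_eq, coordProj_mul_rankCompletion h, rankCompletion_mul_coordProj h,
    ← dropBlock_eq, hF]

/-- With `B = blockInv I F` and `R = F B F`, the relation `B F B = B` gives `R B R = R`, which is
the rank criterion. -/
lemma rank_rankCompletion (h : (paddedBlock I F).det ≠ 0) :
    (rankCompletion I F).rank = I.card := by
  have hp := paddedBlock_rankCompletion h
  have hb : blockInv I (rankCompletion I F) = blockInv I F := by rw [blockInv, hp, blockInv]
  apply rank_of_mul_blockInv_mul_self (by rwa [hp])
  rw [hb]
  calc rankCompletion I F * blockInv I F * rankCompletion I F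
      = F * (blockInv I F * F * blockInv I F * F * blockInv I F) * F := by
        rw [rankCompletion]; simp only [mul_assoc]
    _ = rankCompletion I F := by
        rw [blockInv_mul_mul_blockInv h, blockInv_mul_mul_blockInv h, rankCompletion]

lemma isSymm_rankCompletion (hF : F.IsSymm) : (rankCompletion I F).IsSymm := by
  rw [Matrix.IsSymm, rankCompletion, Matrix.transpose_mul, Matrix.transpose_mul, hF.eq,
    blockInv_transpose hF, mul_assoc]

lemma rankCompletion_mem_symRank (hF : F.IsSymm) (h : (paddedBlock I F).det ≠ 0) :
    rankCompletion I F ∈ symRank n I.card :=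
  ⟨isSymm_rankCompletion hF, rank_rankCompletion h⟩

lemma isSymm_dropBlock (hS : S.IsSymm) : (dropBlock I S).IsSymm := by
  rw [Matrix.IsSymm, dropBlock]
  simp [Matrix.transpose_mul, coordProj_transpose, hS.eq, mul_assoc]

lemma dropBlock_apply (S : Matrix (Fin n) (Fin n) ℝ) (i j : Fin n) :
    dropBlock I S i j = if i ∈ I ∨ j ∈ I then S i j else 0 := by
  have h1 : (1 - coordProj I) = Matrix.diagonal fun i => if i ∈ I then (0:ℝ) else 1 := by
    rw [coordProj, ← Matrix.diagonal_one, Matrix.diagonal_sub]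
    congr 1; ext i; split_ifs <;> simp
  rw [dropBlock, h1, Matrix.sub_apply, Matrix.mul_diagonal, Matrix.diagonal_mul]
  by_cases hi : i ∈ I <;> by_cases hj : j ∈ I <;> simp [hi, hj]

/-! ### Diagonal matrices supported on `I` -/

section Diagonal

variable {l : Fin n → ℝ}

/-- The diagonal matrix with entries `l i` for `i ∈ I` and `0` elsewhere. -/
def diagOn (I : Finset (Fin n)) (l : Fin n → ℝ) : Matrix (Fin n) (Fin n) ℝ :=
  Matrix.diagonal fun i => if i ∈ I then l i else 0

lemma paddedBlock_diagOn :
    paddedBlock I (diagOn I l) = Matrix.diagonal fun i => if i ∈ I then l i else 1 := by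
  rw [paddedBlock, coordProj, diagOn, ← Matrix.diagonal_one, Matrix.diagonal_sub,
    Matrix.diagonal_mul_diagonal, Matrix.diagonal_mul_diagonal, Matrix.diagonal_add]
  congr 1; ext i; by_cases hi : i ∈ I <;> simp [hi]

lemma det_paddedBlock_diagOn (hl : ∀ i ∈ I, l i ≠ 0) : (paddedBlock I (diagOn I l)).det ≠ 0 := by
  rw [paddedBlock_diagOn, Matrix.det_diagonal, Finset.prod_ne_zero_iff]
  intro i _
  split_ifs with hi
  exacts [hl i hi, one_ne_zero]

lemma blockInv_diagOn (hl : ∀ i ∈ I, l i ≠ 0) :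
    blockInv I (diagOn I l) = diagOn I fun i => (l i)⁻¹ := by
  have : (paddedBlock I (diagOn I l))⁻¹
      = Matrix.diagonal fun i => if i ∈ I then (l i)⁻¹ else 1 := by
    apply Matrix.inv_eq_left_inv
    rw [paddedBlock_diagOn, Matrix.diagonal_mul_diagonal, ← Matrix.diagonal_one]
    congr 1; ext i
    by_cases hi : i ∈ I <;> simp [hi]
    exact inv_mul_cancel₀ (hl i hi)
  rw [blockInv, this, coordProj, diagOn, Matrix.diagonal_mul_diagonal,
    Matrix.diagonal_mul_diagonal]
  congr 1; ext i; by_cases hi : i ∈ I <;> simp [hi]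

lemma isSymm_diagOn : (diagOn I l).IsSymm := by
  simp [Matrix.IsSymm, diagOn]

lemma dropBlock_diagOn : dropBlock I (diagOn I l) = diagOn I l := by
  ext i j
  rw [dropBlock_apply, diagOn, Matrix.diagonal_apply]
  by_cases h : i = j
  · subst h; by_cases hi : i ∈ I <;> simp [hi]
  · simp [h]

lemma rank_diagOn (hl : ∀ i ∈ I, l i ≠ 0) : (diagOn I l).rank = I.card := by
  apply rank_of_mul_blockInv_mul_self (det_paddedBlock_diagOn hl)
  rw [blockInv_diagOn hl, diagOn, diagOn, Matrix.diagonal_mul_diagonal,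
    Matrix.diagonal_mul_diagonal]
  congr 1; ext i; by_cases hi : i ∈ I <;> simp [hi]

lemma diagOn_mem_symRank (hl : ∀ i ∈ I, l i ≠ 0) : diagOn I l ∈ symRank n I.card :=
  ⟨isSymm_diagOn, rank_diagOn hl⟩

end Diagonal

end CornerAlgebra

/-! ### Smoothness of the matrix inverse and a local parametrization of `symRank` -/

section Smoothness

variable {n : ℕ}

lemma contDiff_matrix_entry (i j : Fin n) :
    ContDiff ℝ ∞ (fun A : Matrix (Fin n) (Fin n) ℝ => A i j) :=
  contDiff_apply_apply ℝ ℝ i j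

lemma contDiffAt_matrix {E : Type*} [NormedAddCommGroup E] [NormedSpace ℝ E]
    {f : E → Matrix (Fin n) (Fin n) ℝ} {x : E}
    (h : ∀ i j, ContDiffAt ℝ ∞ (fun y => f y i j) x) : ContDiffAt ℝ ∞ f x :=
  contDiffAt_pi.2 fun i => contDiffAt_pi.2 fun j => h i j

lemma ContDiffAt.matrix_entry {E : Type*} [NormedAddCommGroup E] [NormedSpace ℝ E]
    {f : E → Matrix (Fin n) (Fin n) ℝ} {x : E} (h : ContDiffAt ℝ ∞ f x) (i j : Fin n) :
    ContDiffAt ℝ ∞ (fun y => f y i j) x :=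
  (contDiff_matrix_entry i j).contDiffAt.comp x h

lemma ContDiffAt.matrix_mul {E : Type*} [NormedAddCommGroup E] [NormedSpace ℝ E]
    {f g : E → Matrix (Fin n) (Fin n) ℝ} {x : E} (hf : ContDiffAt ℝ ∞ f x)
    (hg : ContDiffAt ℝ ∞ g x) : ContDiffAt ℝ ∞ (fun y => f y * g y) x := by
  refine contDiffAt_matrix fun i j => ?_
  simp only [Matrix.mul_apply]
  exact ContDiffAt.sum fun k _ => (hf.matrix_entry i k).mul (hg.matrix_entry k j)

lemma ContDiffAt.matrix_det {E : Type*} [NormedAddCommGroup E] [NormedSpace ℝ E]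
    {f : E → Matrix (Fin n) (Fin n) ℝ} {x : E} (hf : ContDiffAt ℝ ∞ f x) :
    ContDiffAt ℝ ∞ (fun y => (f y).det) x := by
  simp only [Matrix.det_apply']
  exact ContDiffAt.sum fun s _ => contDiffAt_const.mul
    (contDiffAt_prod fun k _ => hf.matrix_entry (s k) k)

/-- Cramer's rule: each entry is a cofactor divided by the determinant. -/
lemma ContDiffAt.matrix_inv {E : Type*} [NormedAddCommGroup E] [NormedSpace ℝ E]
    {f : E → Matrix (Fin n) (Fin n) ℝ} {x : E} (hf : ContDiffAt ℝ ∞ f x)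
    (h : (f x).det ≠ 0) : ContDiffAt ℝ ∞ (fun y => (f y)⁻¹) x := by
  refine contDiffAt_matrix fun i j => ?_
  simp only [Matrix.inv_def, Ring.inverse_eq_inv', Matrix.smul_apply, smul_eq_mul,
    Matrix.adjugate_apply]
  refine (hf.matrix_det.inv h).mul (ContDiffAt.matrix_det (contDiffAt_matrix fun k l => ?_))
  simp only [Matrix.updateRow_apply]
  split_ifs
  exacts [contDiffAt_const, hf.matrix_entry k l]

lemma ContDiffAt.matrix_paddedBlock {E : Type*} [NormedAddCommGroup E] [NormedSpace ℝ E]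
    {f : E → Matrix (Fin n) (Fin n) ℝ} {x : E} (I : Finset (Fin n)) (hf : ContDiffAt ℝ ∞ f x) :
    ContDiffAt ℝ ∞ (fun y => paddedBlock I (f y)) x :=
  ((contDiffAt_const.matrix_mul hf).matrix_mul contDiffAt_const).add contDiffAt_const

lemma ContDiffAt.matrix_blockInv {E : Type*} [NormedAddCommGroup E] [NormedSpace ℝ E]
    {f : E → Matrix (Fin n) (Fin n) ℝ} {x : E} {I : Finset (Fin n)} (hf : ContDiffAt ℝ ∞ f x)
    (h : (paddedBlock I (f x)).det ≠ 0) : ContDiffAt ℝ ∞ (fun y => blockInv I (f y)) x :=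
  (contDiffAt_const.matrix_mul ((hf.matrix_paddedBlock I).matrix_inv h)).matrix_mul contDiffAt_const

lemma ContDiffAt.matrix_rankCompletion {E : Type*} [NormedAddCommGroup E] [NormedSpace ℝ E]
    {f : E → Matrix (Fin n) (Fin n) ℝ} {x : E} {I : Finset (Fin n)} (hf : ContDiffAt ℝ ∞ f x)
    (h : (paddedBlock I (f x)).det ≠ 0) : ContDiffAt ℝ ∞ (fun y => rankCompletion I (f y)) x :=
  (hf.matrix_mul (hf.matrix_blockInv h)).matrix_mul hf

lemma isOpen_det_paddedBlock_ne_zero (I : Finset (Fin n)) :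
    IsOpen {S : Matrix (Fin n) (Fin n) ℝ | (paddedBlock I S).det ≠ 0} := by
  have h : Continuous fun S : Matrix (Fin n) (Fin n) ℝ => (paddedBlock I S).det :=
    continuous_iff_continuousAt.2 fun S =>
      ((contDiffAt_id (x := S)).matrix_paddedBlock I).matrix_det.continuousAt
  exact isOpen_ne_fun h continuous_const

end Smoothness

/-! ### The graph chart of the rank stratum over its tangent space -/

section Chart

variable {n : ℕ}

/-- The symmetric matrices with vanishing complementary block of `I`: the tangent space of the
manifold of symmetric matrices of rank `#I` at `diagOn I l`. -/
def borderedSpace (I : Finset (Fin n)) : Submodule ℝ (Matrix (Fin n) (Fin n) ℝ) where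
  carrier := {E | E.IsSymm ∧ dropBlock I E = E}
  add_mem' := by
    rintro a b ⟨ha, ha'⟩ ⟨hb, hb'⟩
    refine ⟨ha.add hb, ?_⟩
    rw [dropBlock_eq] at *
    conv_rhs => rw [← ha', ← hb']
    noncomm_ring
  zero_mem' := ⟨Matrix.isSymm_zero, by simp [dropBlock]⟩
  smul_mem' := by
    rintro c a ⟨ha, ha'⟩
    refine ⟨ha.smul c, ?_⟩
    rw [dropBlock_eq] at *
    conv_rhs => rw [← ha']
    simp [smul_sub]

lemma mem_borderedSpace {I : Finset (Fin n)} {E : Matrix (Fin n) (Fin n) ℝ} :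
    E ∈ borderedSpace I ↔ E.IsSymm ∧ ∀ i j, i ∉ I → j ∉ I → E i j = 0 := by
  refine and_congr_right fun _ => ⟨fun h i j hi hj => ?_, fun h => ?_⟩
  · rw [← h, dropBlock_apply, if_neg (by tauto)]
  · ext i j
    rw [dropBlock_apply]
    split_ifs with hij
    · rfl
    · exact (h i j (by tauto) (by tauto)).symm

/-- The linear projection of all matrices onto `borderedSpace I`. -/
def borderedProj (I : Finset (Fin n)) :
    Matrix (Fin n) (Fin n) ℝ →ₗ[ℝ] borderedSpace I where
  -- Symmetrizing first makes the map linear on the whole matrix space, as is needed for open sets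
  -- of the ambient space.
  toFun S := ⟨dropBlock I ((1 / 2 : ℝ) • (S + Sᵀ)), by
    have h : ((1 / 2 : ℝ) • (S + Sᵀ)).IsSymm := by
      rw [Matrix.IsSymm]; simp [add_comm]
    refine mem_borderedSpace.2 ⟨isSymm_dropBlock h, fun i j hi hj => ?_⟩
    rw [dropBlock_apply, if_neg (by tauto)]⟩
  map_add' a b := by
    ext i j
    simp only [dropBlock_apply, Submodule.coe_add, Matrix.add_apply, Matrix.smul_apply,
      Matrix.transpose_apply, smul_eq_mul]
    split_ifs <;> ring
  map_smul' c a := by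
    ext i j
    simp only [dropBlock_apply, Submodule.coe_smul, Matrix.add_apply, Matrix.smul_apply,
      Matrix.transpose_apply, smul_eq_mul, RingHom.id_apply]
    split_ifs <;> ring

lemma borderedProj_of_isSymm {I : Finset (Fin n)} {S : Matrix (Fin n) (Fin n) ℝ}
    (hS : S.IsSymm) : (borderedProj I S : Matrix (Fin n) (Fin n) ℝ) = dropBlock I S := by
  have : (1 / 2 : ℝ) • (S + Sᵀ) = S := by
    rw [hS.eq, ← two_smul ℝ S, smul_smul]; norm_num
  change dropBlock I ((1 / 2 : ℝ) • (S + Sᵀ)) = _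
  rw [this]

lemma borderedProj_coe {I : Finset (Fin n)} (E : borderedSpace I) :
    borderedProj I (E : Matrix (Fin n) (Fin n) ℝ) = E :=
  Subtype.ext ((borderedProj_of_isSymm E.2.1).trans E.2.2)

variable {I : Finset (Fin n)} {l : Fin n → ℝ}

/-- The graph parametrization `u ↦ rankCompletion I (diagOn I l + e u)` of the symmetric matrices of
rank `#I`. -/
lemma isLocalParam_rankCompletion (hl : ∀ i ∈ I, l i ≠ 0) {d : ℕ}
    (e : EuclideanSpace ℝ (Fin d) ≃L[ℝ] borderedSpace I) :
    IsLocalParam (symRank n I.card) (diagOn I l)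
      {u | (paddedBlock I (diagOn I l + e u)).det ≠ 0}
      (fun u => rankCompletion I (diagOn I l + e u)) := by
  have hD : diagOn I l ∈ borderedSpace I := ⟨isSymm_diagOn, dropBlock_diagOn⟩
  have hmem : ∀ u, diagOn I l + e u ∈ borderedSpace I := fun u => add_mem hD (e u).2
  have hlin : ContDiff ℝ ∞ fun u => diagOn I l + (e u : Matrix (Fin n) (Fin n) ℝ) :=
    contDiff_const.add ((borderedSpace I).subtypeL.contDiff.comp e.contDiff)
  have hsm : ∀ u, (paddedBlock I (diagOn I l + e u)).det ≠ 0 →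
      ContDiffAt ℝ ∞ (fun u => rankCompletion I (diagOn I l + e u)) u := fun u hu =>
    hlin.contDiffAt.matrix_rankCompletion hu
  let π := LinearMap.toContinuousLinearMap (borderedProj I)
  have hπD : π (diagOn I l) = ⟨_, hD⟩ := borderedProj_coe ⟨_, hD⟩
  -- A linear left inverse of the chart, up to translation and `e`. It yields injectivity, the
  -- immersion property (by the chain rule) and the openness of images.
  have hπ : ∀ u, (paddedBlock I (diagOn I l + e u)).det ≠ 0 →
      π (rankCompletion I (diagOn I l + e u)) - π (diagOn I l) = e u := by
    intro u hu
    have : π (rankCompletion I (diagOn I l + e u)) = ⟨diagOn I l + e u, hmem u⟩ :=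
      Subtype.ext ((borderedProj_of_isSymm (isSymm_rankCompletion (hmem u).1)).trans
        (dropBlock_rankCompletion hu (hmem u).2))
    rw [this, hπD]
    ext1
    simp
  have hopen : IsOpen {u | (paddedBlock I (diagOn I l + e u)).det ≠ 0} :=
    (isOpen_det_paddedBlock_ne_zero I).preimage hlin.continuous
  refine ⟨hopen, ?_, ?_, fun u hu => (hsm u hu).contDiffWithinAt, ?_, ?_, ?_⟩
  · simpa using det_paddedBlock_diagOn hl
  · have h := rankCompletion_dropBlock (det_paddedBlock_diagOn hl) (rank_diagOn hl)
    rw [dropBlock_diagOn] at h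
    simpa using h
  · intro u hu v hv huv
    apply e.injective
    rw [← hπ u hu, ← hπ v hv]
    exact congrArg (fun S => π S - π (diagOn I l)) huv
  · intro u hu
    have hd := ((hsm u hu).differentiableAt (by simp)).hasFDerivAt
    have h1 := (π.hasFDerivAt.comp u hd).sub_const (π (diagOn I l))
    have h2 : HasFDerivAt (fun u => e u) (e : _ →L[ℝ] borderedSpace I) u := e.hasFDerivAt
    have h3 := h1.unique (h2.congr_of_eventuallyEq
      (Filter.eventuallyEq_of_mem (hopen.mem_nhds hu) fun v hv => hπ v hv))
    intro a b hab
    apply e.injective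
    have h := DFunLike.congr_fun h3
    exact (h a).symm.trans ((congrArg π hab).trans (h b))
  · intro W hW hWo
    refine ⟨{S | (paddedBlock I S).det ≠ 0} ∩
      {S | e.symm (π S - π (diagOn I l)) ∈ W}, ?_, ?_⟩
    · refine (isOpen_det_paddedBlock_ne_zero I).inter (hWo.preimage ?_)
      exact e.symm.continuous.comp (π.continuous.sub continuous_const)
    · ext S
      constructor
      · rintro ⟨u, hu, rfl⟩
        have hu' := hW hu
        refine ⟨⟨?_, ?_⟩, rankCompletion_mem_symRank (hmem u).1 hu'⟩
        · simp only [mem_ofPred_eq]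
          rwa [paddedBlock_rankCompletion hu']
        · simp only [mem_ofPred_eq]
          rwa [hπ u hu', e.symm_apply_apply]
      · rintro ⟨⟨h1, h2⟩, hS, hr⟩
        refine ⟨_, h2, ?_⟩
        have : (π S : Matrix (Fin n) (Fin n) ℝ) = dropBlock I S := borderedProj_of_isSymm hS
        simp only [ContinuousLinearEquiv.apply_symm_apply, hπD, Submodule.coe_sub, this,
          add_sub_cancel]
        exact rankCompletion_dropBlock h1 hr

lemma isSmoothPoint_diagOn (hl : ∀ i ∈ I, l i ≠ 0) :
    IsSmoothPoint (symRank n I.card) (diagOn I l) :=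
  ⟨_, _, _, isLocalParam_rankCompletion hl
    (ContinuousLinearEquiv.ofFinrankEq (by rw [finrank_euclideanSpace_fin]) :
      EuclideanSpace ℝ (Fin (Module.finrank ℝ (borderedSpace I))) ≃L[ℝ] borderedSpace I)⟩

end Chart

/-! ### Counting negative eigenvalues -/

section Inertia

variable {d : ℕ} {H : Matrix (Fin d) (Fin d) ℝ}

lemma dotProduct_mulVec_eq_sum_eigenvalues (hH : H.IsHermitian) (u : EuclideanSpace ℝ (Fin d)) :
    u.ofLp ⬝ᵥ H *ᵥ u.ofLp
      = ∑ i, hH.eigenvalues i * (hH.eigenvectorBasis.repr u i) ^ 2 := by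
  have h1 : u.ofLp ⬝ᵥ H *ᵥ u.ofLp = inner ℝ u (WithLp.toLp 2 (H *ᵥ u.ofLp)) := by
    rw [EuclideanSpace.inner_eq_star_dotProduct, dotProduct_comm]
    simp
  rw [h1, ← hH.eigenvectorBasis.sum_inner_mul_inner]
  refine Finset.sum_congr rfl fun i _ => ?_
  have h2 : inner ℝ (hH.eigenvectorBasis i) (WithLp.toLp 2 (H *ᵥ u.ofLp))
      = hH.eigenvalues i * inner ℝ (hH.eigenvectorBasis i) u := by
    have hs : Hᵀ = H := by rwa [← Matrix.conjTranspose_eq_transpose_of_trivial]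
    have h3 := hH.mulVec_eigenvectorBasis i
    rw [EuclideanSpace.inner_eq_star_dotProduct, EuclideanSpace.inner_eq_star_dotProduct]
    simp only [star_trivial]
    rw [← Matrix.vecMul_transpose, hs, ← Matrix.dotProduct_mulVec, h3]
    simp [dotProduct_smul]
  rw [h2, hH.eigenvectorBasis.repr_apply_apply, real_inner_comm]
  ring

lemma numNegEigenvalues_eq_card (hH : H.IsHermitian) :
    numNegEigenvalues H = Fintype.card {i // hH.eigenvalues i < 0} := by
  classical
  rw [numNegEigenvalues, hH.roots_charpoly_eq_eigenvalues, Multiset.filter_map,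
    Multiset.card_map, Fintype.card_subtype]
  rfl

/-- **Sylvester's law of inertia**, as a criterion: a symmetric form that is nonnegative on the
kernel of a map to `ℝ^κ` and negative on an embedded copy of `ℝ^κ` has `#κ` negative eigenvalues. -/
lemma numNegEigenvalues_eq_of_forms {κ : Type*} [Fintype κ] (hH : H.IsHermitian)
    (f : EuclideanSpace ℝ (Fin d) →ₗ[ℝ] (κ → ℝ)) (m : (κ → ℝ) →ₗ[ℝ] EuclideanSpace ℝ (Fin d))
    (hpos : ∀ u, f u = 0 → 0 ≤ u.ofLp ⬝ᵥ H *ᵥ u.ofLp)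
    (hneg : ∀ w, w ≠ 0 → (m w).ofLp ⬝ᵥ H *ᵥ (m w).ofLp < 0) :
    numNegEigenvalues H = Fintype.card κ := by
  rw [numNegEigenvalues_eq_card hH]
  set b := hH.eigenvectorBasis
  let ext : ({i // hH.eigenvalues i < 0} → ℝ) →ₗ[ℝ] EuclideanSpace ℝ (Fin d) :=
    { toFun := fun y => WithLp.toLp 2 fun i => if h : hH.eigenvalues i < 0 then y ⟨i, h⟩ else 0
      map_add' := by intro y z; ext i; by_cases h : hH.eigenvalues i < 0 <;> simp [h]
      map_smul' := by intro c y; ext i; by_cases h : hH.eigenvalues i < 0 <;> simp [h] }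
  let res : EuclideanSpace ℝ (Fin d) →ₗ[ℝ] ({i // hH.eigenvalues i < 0} → ℝ) :=
    { toFun := fun y i => y i.1
      map_add' := by intro y z; rfl
      map_smul' := by intro c y; rfl }
  apply le_antisymm
  -- The form is negative definite on the span of the negative eigenvectors, so that span meets `ker
  -- f` only in `0`.
  · have hinj : Function.Injective (f ∘ₗ b.repr.symm.toLinearEquiv.toLinearMap ∘ₗ ext) := by
      rw [← LinearMap.ker_eq_bot, LinearMap.ker_eq_bot']
      intro y hy
      have h := hpos _ hy
      rw [dotProduct_mulVec_eq_sum_eigenvalues hH] at h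
      have hr : ∀ i, b.repr (b.repr.symm.toLinearEquiv.toLinearMap (ext y)) i = ext y i := by
        intro i
        exact congrArg (fun v => v.ofLp i) (b.repr.apply_symm_apply (ext y))
      have hterm : ∀ i, hH.eigenvalues i * (ext y i) ^ 2 ≤ 0 := by
        intro i
        by_cases hi : hH.eigenvalues i < 0
        · exact mul_nonpos_of_nonpos_of_nonneg hi.le (sq_nonneg _)
        · simp [ext, hi]
      have h' : 0 ≤ ∑ i, hH.eigenvalues i * (ext y i) ^ 2 :=
        h.trans_eq (Finset.sum_congr rfl fun i _ =>
          congrArg (fun z => hH.eigenvalues i * z ^ 2) (hr i))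
      have hz := (Finset.sum_eq_zero_iff_of_nonpos fun i _ => hterm i).1
        (le_antisymm (Finset.sum_nonpos fun i _ => hterm i) h')
      funext i
      have hi := hz i.1 (Finset.mem_univ _)
      have he : ext y i.1 = y i := by simp [ext, i.2]
      rw [he] at hi
      simpa [i.2.ne] using hi
    simpa using LinearMap.finrank_le_finrank_of_injective hinj
  -- A vector without components along negative eigenvectors has nonnegative form, so `m w` with `w
  -- ≠ 0` is not one.
  · have hinj : Function.Injective (res ∘ₗ b.repr.toLinearEquiv.toLinearMap ∘ₗ m) := by
      rw [← LinearMap.ker_eq_bot, LinearMap.ker_eq_bot']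
      intro w hw
      by_contra hne
      have h := hneg w hne
      rw [dotProduct_mulVec_eq_sum_eigenvalues hH] at h
      refine absurd h (not_lt.2 (Finset.sum_nonneg fun i _ => ?_))
      by_cases hi : hH.eigenvalues i < 0
      · have : b.repr (m w) i = 0 := congrFun hw ⟨i, hi⟩
        rw [this]; simp
      · exact mul_nonneg (not_lt.1 hi) (sq_nonneg _)
    simpa using LinearMap.finrank_le_finrank_of_injective hinj

end Inertia

/-! ### Second-order expansions -/

section SecondOrder

open Filter

/-- One application of L'Hôpital's rule: the new quotient is half the difference quotient of `t ↦
fderiv ℝ g (t • u) u`, whose value at `0` vanishes by `h0`. -/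
lemma tendsto_second_order_of_fderiv_eq_zero {E : Type*} [NormedAddCommGroup E]
    [NormedSpace ℝ E] {g : E → ℝ} (hg : ContDiffAt ℝ 2 g 0) {u : E} (h0 : fderiv ℝ g 0 u = 0) :
    Tendsto (fun t : ℝ => (g (t • u) - g 0) / t ^ 2) (𝓝[≠] 0)
      (𝓝 (fderiv ℝ (fderiv ℝ g) 0 u u / 2)) := by
  have hline : ∀ t : ℝ, HasDerivAt (fun t : ℝ => t • u) u t := fun t => by
    simpa using (hasDerivAt_id t).smul_const u
  have hcont : Tendsto (fun t : ℝ => t • u) (𝓝 0) (𝓝 0) := by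
    simpa using (hline 0).continuousAt.tendsto
  have hdiff : ∀ᶠ t : ℝ in 𝓝 0, HasDerivAt (fun t => g (t • u) - g 0) (fderiv ℝ g (t • u) u) t := by
    have h1 : ∀ᶠ x in 𝓝 (0 : E), DifferentiableAt ℝ g x := by
      filter_upwards [hg.eventually (by simp)] with x hx using hx.differentiableAt (by simp)
    filter_upwards [hcont.eventually h1] with t ht
    exact (ht.hasFDerivAt.comp_hasDerivAt t (hline t)).sub_const _
  have hd2 : HasDerivAt (fun t : ℝ => fderiv ℝ g (t • u) u) (fderiv ℝ (fderiv ℝ g) 0 u u) 0 := by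
    have h1 : DifferentiableAt ℝ (fderiv ℝ g) ((0 : ℝ) • u) := by
      rw [zero_smul]
      exact (hg.fderiv_right (m := 1) (by norm_num)).differentiableAt (by simp)
    have h2 : HasDerivAt (fun t : ℝ => fderiv ℝ g (t • u))
        (fderiv ℝ (fderiv ℝ g) ((0 : ℝ) • u) u) 0 :=
      h1.hasFDerivAt.comp_hasDerivAt (0 : ℝ) (hline 0)
    rw [zero_smul] at h2
    exact (ContinuousLinearMap.apply ℝ ℝ u).hasFDerivAt.comp_hasDerivAt (0 : ℝ) h2
  refine HasDerivAt.lhopital_zero_nhdsNE (f' := fun t => fderiv ℝ g (t • u) u)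
    (g' := fun t => 2 * t) (hdiff.filter_mono nhdsWithin_le_nhds) ?_ ?_ ?_ ?_ ?_
  · exact Eventually.of_forall fun t => by simpa using hasDerivAt_pow 2 t
  · filter_upwards [self_mem_nhdsWithin] with t ht
    simpa using ht
  · have := (hdiff.self_of_nhds).continuousAt.tendsto
    simp only [zero_smul, sub_self] at this
    exact this.mono_left nhdsWithin_le_nhds
  · have : Tendsto (fun t : ℝ => t ^ 2) (𝓝 0) (𝓝 0) := by
      simpa using (continuous_pow 2 : Continuous fun t : ℝ => t ^ 2).tendsto 0
    exact this.mono_left nhdsWithin_le_nhds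
  · have h := (hasDerivAt_iff_tendsto_slope.1 hd2).div_const 2
    refine h.congr fun t => ?_
    simp only [slope_def_field, zero_smul, h0, sub_zero]
    ring

lemma dotProduct_hessianAtZero_mulVec {d : ℕ} (g : EuclideanSpace ℝ (Fin d) → ℝ)
    (u : EuclideanSpace ℝ (Fin d)) :
    u.ofLp ⬝ᵥ hessianAtZero g *ᵥ u.ofLp = fderiv ℝ (fderiv ℝ g) 0 u u := by
  have hu : u = ∑ i, u i • EuclideanSpace.single i (1 : ℝ) := by
    ext j; simp [Finset.sum_apply, Pi.single_apply]
  conv_rhs => rw [hu]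
  simp only [map_sum, map_smul, _root_.sum_apply, _root_.smul_apply,
    smul_eq_mul, dotProduct, mulVec, hessianAtZero, Matrix.of_apply, Finset.mul_sum]
  rw [Finset.sum_comm]
  refine Finset.sum_congr rfl fun i _ => Finset.sum_congr rfl fun j _ => ?_
  ring

lemma isHermitian_hessianAtZero {d : ℕ} {g : EuclideanSpace ℝ (Fin d) → ℝ}
    (hg : ContDiffAt ℝ 2 g 0) : (hessianAtZero g).IsHermitian := by
  have h := hg.isSymmSndFDerivAt (by simp)
  ext i j
  simp only [Matrix.conjTranspose_apply, star_trivial, hessianAtZero, Matrix.of_apply]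
  exact h.eq _ _

end SecondOrder

/-! ### Transport under linear isomorphisms -/

section Transport

variable {V V' : Type*} [NormedAddCommGroup V] [NormedSpace ℝ V] [NormedAddCommGroup V']
  [NormedSpace ℝ V'] {X : Set V} {X' : Set V'} {e : V ≃L[ℝ] V'}

lemma IsLocalParam.map (he : ∀ v, e v ∈ X' ↔ v ∈ X) {s : V} {d : ℕ}
    {U : Set (EuclideanSpace ℝ (Fin d))} {p : EuclideanSpace ℝ (Fin d) → V}
    (h : IsLocalParam X s U p) : IsLocalParam X' (e s) U (e ∘ p) where
  isOpen := h.isOpen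
  zero_mem := h.zero_mem
  map_zero := by simp [h.map_zero]
  contDiffOn := e.contDiff.comp_contDiffOn h.contDiffOn
  injOn := e.injective.comp_injOn h.injOn
  immersion u hu := by
    rw [e.comp_fderiv]
    exact e.injective.comp (h.immersion u hu)
  image_open W hW hWo := by
    obtain ⟨O, hO, hOW⟩ := h.image_open W hW hWo
    refine ⟨e.symm ⁻¹' O, hO.preimage e.symm.continuous, ?_⟩
    rw [image_comp, hOW]
    ext v
    constructor
    · rintro ⟨w, ⟨hw, hwX⟩, rfl⟩
      exact ⟨by simpa using hw, (he w).2 hwX⟩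
    · rintro ⟨hv, hvX⟩
      exact ⟨e.symm v, ⟨hv, (he _).1 (by simpa using hvX)⟩, by simp⟩

lemma mem_of_symm_mem (he : ∀ v, e v ∈ X' ↔ v ∈ X) (v : V') : e.symm v ∈ X ↔ v ∈ X' := by
  rw [← he, e.apply_symm_apply]

lemma IsSmoothPoint.map (he : ∀ v, e v ∈ X' ↔ v ∈ X) {s : V} (h : IsSmoothPoint X s) :
    IsSmoothPoint X' (e s) := by
  obtain ⟨d, U, p, hp⟩ := h
  exact ⟨d, U, e ∘ p, hp.map he⟩

lemma tangentVectors_symm (he : ∀ v, e v ∈ X' ↔ v ∈ X) {s : V} {v : V'}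
    (hv : v ∈ tangentVectors X' (e s)) : e.symm v ∈ tangentVectors X s := by
  obtain ⟨c, h0, hc, hX, rfl⟩ := hv
  refine ⟨e.symm ∘ c, by simp [h0], e.symm.contDiff.contDiffAt.comp _ hc, ?_, ?_⟩
  · filter_upwards [hX] with t ht using (mem_of_symm_mem he _).2 ht
  · have := (hc.differentiableAt (by simp)).hasDerivAt
    exact (e.symm.hasFDerivAt.comp_hasDerivAt (0 : ℝ) this).deriv

lemma map_mem_criticalPointsOn (he : ∀ v, e v ∈ X' ↔ v ∈ X) {f : V' → ℝ} {g : V → ℝ}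
    (hfg : ∀ v, f (e v) = g v) {s : V} (h : s ∈ criticalPointsOn g X) :
    e s ∈ criticalPointsOn f X' := by
  obtain rfl : f ∘ e = g := funext hfg
  obtain ⟨hs, hsm, hcrit⟩ := h
  refine ⟨(he s).2 hs, hsm.map he, fun v hv => ?_⟩
  have := hcrit _ (tangentVectors_symm he hv)
  rw [e.comp_right_fderiv] at this
  simpa using this

lemma criticalPointsOn_eq_image (he : ∀ v, e v ∈ X' ↔ v ∈ X) {f : V' → ℝ} {g : V → ℝ}
    (hfg : ∀ v, f (e v) = g v) : criticalPointsOn f X' = e '' criticalPointsOn g X := by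
  refine Subset.antisymm (fun s hs => ⟨e.symm s, ?_, e.apply_symm_apply s⟩) ?_
  · exact map_mem_criticalPointsOn (e := e.symm) (mem_of_symm_mem he)
      (fun v => by rw [← hfg, e.apply_symm_apply]) hs
  · rintro _ ⟨s, hs, rfl⟩
    exact map_mem_criticalPointsOn he hfg hs

lemma HasIndexOn.map (he : ∀ v, e v ∈ X' ↔ v ∈ X) {f : V' → ℝ} {g : V → ℝ}
    (hfg : ∀ v, f (e v) = g v) {s : V} {k : ℕ} (h : HasIndexOn g X s k) :
    HasIndexOn f X' (e s) k := by
  obtain rfl : f ∘ e = g := funext hfg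
  refine ⟨h.1.map he, fun d U p hp => ?_⟩
  have h' := h.2 d U (e.symm ∘ p)
    (by simpa using IsLocalParam.map (e := e.symm) (mem_of_symm_mem he) hp)
  rwa [show (f ∘ e) ∘ (e.symm ∘ p) = f ∘ p by ext; simp] at h'

end Transport

/-! ### The dimension of `symRank` -/

section Dimension

variable {n : ℕ} {I : Finset (Fin n)} {l : Fin n → ℝ}

lemma IsLocalParam.mem {V : Type*} [NormedAddCommGroup V] [NormedSpace ℝ V] {X : Set V} {s : V}
    {d : ℕ} {U : Set (EuclideanSpace ℝ (Fin d))} {p : EuclideanSpace ℝ (Fin d) → V}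
    (h : IsLocalParam X s U p) {u : EuclideanSpace ℝ (Fin d)} (hu : u ∈ U) : p u ∈ X := by
  obtain ⟨O, _, hO⟩ := h.image_open U subset_rfl h.isOpen
  have : p u ∈ O ∩ X := hO ▸ mem_image_of_mem p hu
  exact this.2

/-- A `C¹` map from `ℝ^d` whose image contains an open set has a target of dimension at most
`d`. -/
lemma finrank_le_of_image_ball_mem_nhds {F : Type*} [NormedAddCommGroup F] [NormedSpace ℝ F]
    [FiniteDimensional ℝ F] {d : ℕ} {f : EuclideanSpace ℝ (Fin d) → F} {ε : ℝ} (hε : 0 < ε)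
    (hf : ContDiffOn ℝ 1 f (Metric.ball 0 ε)) {y : F} (h : f '' Metric.ball 0 ε ∈ 𝓝 y) :
    Module.finrank ℝ F ≤ d := by
  by_contra! hlt
  -- A `C¹` map does not raise Hausdorff dimension, and the ball has dimension `d`.
  have hdense : Dense (f '' Metric.ball 0 ε)ᶜ := by
    refine hf.dense_compl_image_of_dimH_lt_finrank (convex_ball _ _) subset_rfl ?_
    rw [Real.dimH_of_mem_nhds (Metric.ball_mem_nhds _ hε), finrank_euclideanSpace_fin]
    exact_mod_cast hlt
  have h' := mem_interior_iff_mem_nhds.2 h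
  rw [interior_eq_empty_iff_dense_compl.2 hdense] at h'
  exact h'

lemma continuousAt_rankCompletion_coe (F : borderedSpace I)
    (hF : (paddedBlock I (F : Matrix (Fin n) (Fin n) ℝ)).det ≠ 0) :
    ContinuousAt (fun E : borderedSpace I => rankCompletion I E.1) F := by
  have h : ContDiffAt ℝ ∞ (fun E : borderedSpace I => E.1) F :=
    (borderedSpace I).subtypeL.contDiff.contDiffAt
  exact (h.matrix_rankCompletion hF).continuousAt

/-- A local parametrization cannot have fewer parameters than the dimension of `borderedSpace I`:
otherwise its composition with the projection would have an image with dense complement. -/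
lemma finrank_borderedSpace_le (hl : ∀ i ∈ I, l i ≠ 0) {d : ℕ}
    {U : Set (EuclideanSpace ℝ (Fin d))} {p : EuclideanSpace ℝ (Fin d) → Matrix (Fin n) (Fin n) ℝ}
    (h : IsLocalParam (symRank n I.card) (diagOn I l) U p) :
    Module.finrank ℝ (borderedSpace I) ≤ d := by
  let π := LinearMap.toContinuousLinearMap (borderedProj I)
  obtain ⟨D, hD⟩ : ∃ D : borderedSpace I, D.1 = diagOn I l :=
    ⟨⟨diagOn I l, isSymm_diagOn, dropBlock_diagOn⟩, rfl⟩
  obtain ⟨ε, hε, hball⟩ := Metric.isOpen_iff.1 h.isOpen 0 h.zero_mem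
  obtain ⟨O, hO, hpO⟩ := h.image_open _ hball Metric.isOpen_ball
  have hf : ContDiffOn ℝ 1 (π ∘ p) (Metric.ball 0 ε) :=
    (π.contDiff.comp_contDiffOn (h.contDiffOn.mono hball)).of_le (by simp)
  have hdet : (paddedBlock I D.1).det ≠ 0 := hD ▸ det_paddedBlock_diagOn hl
  have hcont := continuousAt_rankCompletion_coe D hdet
  have hDO : rankCompletion I D.1 ∈ O := by
    have h1 := rankCompletion_dropBlock (det_paddedBlock_diagOn hl) (rank_diagOn hl)
    rw [dropBlock_diagOn] at h1
    have : p 0 ∈ O ∩ symRank n I.card := hpO ▸ mem_image_of_mem p (Metric.mem_ball_self hε)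
    rw [hD, h1, ← h.map_zero]
    exact this.1
  -- Every `E` near `D` is the projection of `rankCompletion I E`, which lies in `O` by continuity
  -- and so in the image of `p`.
  have hnhds : (π ∘ p) '' Metric.ball 0 ε ∈ 𝓝 D := by
    have h1 := hcont.preimage_mem_nhds (hO.mem_nhds hDO)
    have h2 : ∀ᶠ E : borderedSpace I in 𝓝 D, (paddedBlock I E.1).det ≠ 0 :=
      continuousAt_subtype_val.eventually ((isOpen_det_paddedBlock_ne_zero I).mem_nhds hdet)
    filter_upwards [h1, h2] with E hE1 hE2
    have hE3 : rankCompletion I E.1 ∈ p '' Metric.ball 0 ε := by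
      rw [hpO]
      exact ⟨hE1, rankCompletion_mem_symRank E.2.1 hE2⟩
    obtain ⟨u, hu, hpu⟩ := hE3
    refine ⟨u, hu, ?_⟩
    rw [Function.comp_apply, hpu]
    exact Subtype.ext ((borderedProj_of_isSymm (isSymm_rankCompletion E.2.1)).trans
      (dropBlock_rankCompletion hE2 E.2.2))
  exact finrank_le_of_image_ball_mem_nhds hε hf hnhds

end Dimension

/-! ### Curves of matrices of constant rank -/

section Curves

open Filter

variable {n : ℕ} {I : Finset (Fin n)} {l : Fin n → ℝ} {c : ℝ → Matrix (Fin n) (Fin n) ℝ}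

lemma hasDerivAt_matrix_entry (hc : ContDiffAt ℝ ∞ c 0) (i j : Fin n) :
    HasDerivAt (fun t => c t i j) (deriv c 0 i j) 0 := by
  have h := (hc.differentiableAt (by simp)).hasDerivAt
  exact hasDerivAt_pi.1 (hasDerivAt_pi.1 h i) j

lemma tendsto_matrix_entry_sub_div (hc : ContDiffAt ℝ ∞ c 0) (i j : Fin n) :
    Tendsto (fun t => (c t i j - c 0 i j) / t) (𝓝[≠] 0) (𝓝 (deriv c 0 i j)) := by
  refine (hasDerivAt_iff_tendsto_slope.1 (hasDerivAt_matrix_entry hc i j)).congr fun t => ?_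
  rw [slope_def_field, sub_zero]

lemma diagOn_apply_of_notMem {j : Fin n} (hj : j ∉ I) (k : Fin n) : diagOn I l j k = 0 := by
  rw [diagOn, Matrix.diagonal_apply]; simp [hj]

lemma diagOn_apply_of_notMem' {j : Fin n} (hj : j ∉ I) (k : Fin n) : diagOn I l k j = 0 := by
  rw [← isSymm_diagOn.apply, diagOn_apply_of_notMem hj]

/-- The complementary block of a curve of rank-`#I` matrices through `diagOn I l` vanishes to second
order, with the second-order term given by the Schur complement. -/
lemma tendsto_complBlock_div_sq (hl : ∀ i ∈ I, l i ≠ 0) (h0 : c 0 = diagOn I l)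
    (hc : ContDiffAt ℝ ∞ c 0) (hX : ∀ᶠ t in 𝓝 (0 : ℝ), c t ∈ symRank n I.card) {j k : Fin n}
    (hj : j ∉ I) (hk : k ∉ I) :
    Tendsto (fun t => c t j k / t ^ 2) (𝓝[≠] 0)
      (𝓝 ((deriv c 0 * diagOn I (fun i => (l i)⁻¹) * deriv c 0) j k)) := by
  have hdet0 : (paddedBlock I (c 0)).det ≠ 0 := h0 ▸ det_paddedBlock_diagOn hl
  have hdet : ∀ᶠ t in 𝓝 (0 : ℝ), (paddedBlock I (c t)).det ≠ 0 :=
    hc.continuousAt.eventually ((isOpen_det_paddedBlock_ne_zero I).mem_nhds hdet0)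
  have hinv : ∀ a b, Tendsto (fun t => blockInv I (c t) a b) (𝓝[≠] 0)
      (𝓝 (diagOn I (fun i => (l i)⁻¹) a b)) := by
    intro a b
    have := ((hc.matrix_blockInv hdet0).matrix_entry a b).continuousAt.tendsto
    rw [h0, blockInv_diagOn hl] at this
    exact this.mono_left nhdsWithin_le_nhds
  have hrow : ∀ a, Tendsto (fun t => c t j a / t) (𝓝[≠] 0) (𝓝 (deriv c 0 j a)) := by
    intro a
    simpa [h0, diagOn_apply_of_notMem hj] using tendsto_matrix_entry_sub_div hc j a
  have hcol : ∀ b, Tendsto (fun t => c t b k / t) (𝓝[≠] 0) (𝓝 (deriv c 0 b k)) := by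
    intro b
    simpa [h0, diagOn_apply_of_notMem' hk] using tendsto_matrix_entry_sub_div hc b k
  simp only [Matrix.mul_apply]
  refine Tendsto.congr' ?_ (tendsto_finsetSum _ fun b _ =>
    (tendsto_finsetSum _ fun a _ => (hrow a).mul (hinv a b)).mul (hcol b))
  filter_upwards [(hdet.and hX).filter_mono nhdsWithin_le_nhds] with t ht
  -- In `c = c * blockInv I c * c`, row `j` of the left factor and column `k` of the right one
  -- vanish at `t = 0`, so each absorbs one factor `1 / t`.
  have h := congrFun (congrFun (mul_blockInv_mul_self_of_rank ht.1 ht.2.2) j) k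
  conv_rhs => rw [← h]
  simp only [Matrix.mul_apply, Finset.sum_div, Finset.sum_mul]
  refine Finset.sum_congr rfl fun b _ => Finset.sum_congr rfl fun a _ => ?_
  ring

/-- Symmetry passes to the derivative, and a block of order `t²` has zero velocity. -/
lemma deriv_mem_borderedSpace (hl : ∀ i ∈ I, l i ≠ 0) (h0 : c 0 = diagOn I l)
    (hc : ContDiffAt ℝ ∞ c 0) (hX : ∀ᶠ t in 𝓝 (0 : ℝ), c t ∈ symRank n I.card) :
    deriv c 0 ∈ borderedSpace I := by
  refine mem_borderedSpace.2 ⟨?_, fun j k hj hk => ?_⟩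
  · refine Matrix.IsSymm.ext fun i j => ?_
    refine (hasDerivAt_matrix_entry hc j i).unique
      ((hasDerivAt_matrix_entry hc i j).congr_of_eventuallyEq ?_)
    filter_upwards [hX] with t ht using ht.1.apply i j
  · have h1 := (tendsto_complBlock_div_sq hl h0 hc hX hj hk).mul
      ((tendsto_id (α := ℝ) (x := 𝓝 0)).mono_left (nhdsWithin_le_nhds (s := {0}ᶜ)))
    have h2 := tendsto_matrix_entry_sub_div hc j k
    rw [mul_zero] at h1
    refine tendsto_nhds_unique (h2.congr' ?_) h1
    filter_upwards [self_mem_nhdsWithin] with t ht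
    have ht : t ≠ 0 := ht
    rw [h0, diagOn_apply_of_notMem hj, id]
    field_simp
    ring

end Curves

/-! ### First- and second-order expansion of the Gaussian loss -/

section Loss

open Filter

variable {n : ℕ}

/-- The loss is a quadratic polynomial, so its Taylor expansion is exact. Both the gradient and the
second-order limit are read off from it. -/
lemma gaussianLoss_add (T S E : Matrix (Fin n) (Fin n) ℝ) :
    gaussianLoss T (S + E) = gaussianLoss T S
      + (4 * ((S - T)ᵀ * E).trace + 2 * (S - T).trace * E.trace)
      + (2 * (Eᵀ * E).trace + E.trace ^ 2) := by
  have h : (Eᵀ * (S - T)).trace = ((S - T)ᵀ * E).trace := by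
    rw [← Matrix.trace_transpose, Matrix.transpose_mul, Matrix.transpose_transpose]
  rw [gaussianLoss, gaussianLoss, add_sub_right_comm, Matrix.transpose_add, add_mul, mul_add,
    mul_add]
  simp only [Matrix.trace_add]
  rw [h]
  ring

lemma contDiff_gaussianLoss (T : Matrix (Fin n) (Fin n) ℝ) : ContDiff ℝ ∞ (gaussianLoss T) := by
  have h : ∀ i j, ContDiff ℝ ∞ fun S : Matrix (Fin n) (Fin n) ℝ => (S - T) i j := fun i j =>
    (contDiff_matrix_entry i j).sub contDiff_const
  unfold gaussianLoss
  simp only [Matrix.trace, Matrix.diag, Matrix.mul_apply, Matrix.transpose_apply]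
  exact (contDiff_const.mul (ContDiff.sum fun i _ => ContDiff.sum fun j _ =>
    (h j i).mul (h j i))).add ((ContDiff.sum fun i _ => h i i).pow 2)

lemma fderiv_gaussianLoss (T S E : Matrix (Fin n) (Fin n) ℝ) :
    fderiv ℝ (gaussianLoss T) S E = 4 * ((S - T)ᵀ * E).trace + 2 * (S - T).trace * E.trace := by
  have hd := (contDiff_gaussianLoss T).differentiable (by simp) S
  refine (hd.lineDeriv_eq_fderiv (v := E)).symm.trans ?_
  rw [lineDeriv]
  set a := 4 * ((S - T)ᵀ * E).trace + 2 * (S - T).trace * E.trace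
  set b := 2 * (Eᵀ * E).trace + E.trace ^ 2
  have h : (fun t : ℝ => gaussianLoss T (S + t • E))
      = fun t => gaussianLoss T S + t * a + t ^ 2 * b := by
    funext t
    rw [gaussianLoss_add]
    simp only [Matrix.mul_smul, Matrix.smul_mul, Matrix.transpose_smul, Matrix.trace_smul,
      smul_eq_mul, a, b]
    ring
  rw [h]
  have h1 : HasDerivAt (fun t : ℝ => gaussianLoss T S + t * a + t ^ 2 * b) a 0 := by
    have := (((hasDerivAt_id (0 : ℝ)).mul_const a).const_add (gaussianLoss T S)).add
      ((hasDerivAt_pow 2 (0 : ℝ)).mul_const b)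
    exact this.congr_deriv (by simp)
  exact h1.deriv

variable {σ : Fin n → ℝ} {I : Finset (Fin n)}

/-- The shifted eigenvalues `σ_i + c_I`. -/
def shifted (σ : Fin n → ℝ) (I : Finset (Fin n)) (i : Fin n) : ℝ := σ i + eigShift σ I

lemma diagOn_sub_diagonal :
    diagOn I (shifted σ I) - Matrix.diagonal σ
      = Matrix.diagonal fun i => if i ∈ I then eigShift σ I else - σ i := by
  rw [diagOn, Matrix.diagonal_sub]
  congr 1; ext i
  split_ifs <;> simp [shifted]

/-- This is where the denominator `#I + 2` enters: `#I * c - c * (#I + 2) = -2 * c`. The value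
cancels the entries in `I` in the differential. -/
lemma trace_diagOn_sub_diagonal :
    (diagOn I (shifted σ I) - Matrix.diagonal σ).trace = - 2 * eigShift σ I := by
  rw [diagOn_sub_diagonal, Matrix.trace_diagonal, Finset.sum_ite, Finset.filter_mem_eq_inter,
    Finset.univ_inter, Finset.sum_const, nsmul_eq_mul, Finset.sum_neg_distrib]
  have h1 : (Finset.univ.filter fun i => i ∉ I) = Iᶜ := by ext; simp
  have h2 : (I.card : ℝ) + 2 ≠ 0 := by positivity
  have h3 : ∑ j ∈ Iᶜ, σ j = eigShift σ I * ((I.card : ℝ) + 2) := by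
    rw [eigShift, div_mul_cancel₀ _ h2]
  rw [h1, h3]
  ring

/-- The differential of the loss at the diagonal critical matrix only sees the complementary
block. -/
lemma linear_part_diagOn (E : Matrix (Fin n) (Fin n) ℝ) :
    4 * ((diagOn I (shifted σ I) - Matrix.diagonal σ)ᵀ * E).trace
      + 2 * (diagOn I (shifted σ I) - Matrix.diagonal σ).trace * E.trace
      = ∑ j ∈ Iᶜ, -4 * shifted σ I j * E j j := by
  rw [trace_diagOn_sub_diagonal, diagOn_sub_diagonal, Matrix.diagonal_transpose]
  simp only [Matrix.trace, Matrix.diag, Matrix.diagonal_mul, Finset.mul_sum]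
  rw [← Finset.sum_add_distrib, ← Finset.sum_add_sum_compl I, Finset.sum_eq_zero, zero_add]
  · refine Finset.sum_congr rfl fun j hj => ?_
    rw [if_neg (Finset.mem_compl.1 hj), shifted]; ring
  · intro i hi
    rw [if_pos hi]; ring

lemma fderiv_gaussianLoss_diagOn {E : Matrix (Fin n) (Fin n) ℝ} (hE : E ∈ borderedSpace I) :
    fderiv ℝ (gaussianLoss (Matrix.diagonal σ)) (diagOn I (shifted σ I)) E = 0 := by
  rw [fderiv_gaussianLoss, linear_part_diagOn]
  refine Finset.sum_eq_zero fun j hj => ?_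
  have hj := Finset.mem_compl.1 hj
  rw [(mem_borderedSpace.1 hE).2 j j hj hj, mul_zero]

/-- Half the second derivative of the loss along curves of rank-`#I` matrices. -/
def lossForm (σ : Fin n → ℝ) (I : Finset (Fin n)) (v : Matrix (Fin n) (Fin n) ℝ) : ℝ :=
  ∑ j ∈ Iᶜ, -4 * shifted σ I j * (v * diagOn I (fun i => (shifted σ I i)⁻¹) * v) j j
    + (2 * (vᵀ * v).trace + v.trace ^ 2)

/-- By symmetry an entry `v i j` with `i ∈ I`, `j ∉ I` occurs twice in the Frobenius norm,
contributing `4`; the Schur complement term contributes `-4` times the quotient of shifted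
eigenvalues. -/
lemma lossForm_eq {v : Matrix (Fin n) (Fin n) ℝ} (hv : v ∈ borderedSpace I) :
    lossForm σ I v = 2 * ∑ i ∈ I, ∑ k ∈ I, v i k ^ 2 + v.trace ^ 2
      + ∑ i ∈ I, ∑ j ∈ Iᶜ, 4 * (1 - shifted σ I j / shifted σ I i) * v i j ^ 2 := by
  obtain ⟨hs, hz⟩ := mem_borderedSpace.1 hv
  have h1 : ∀ j, (v * diagOn I (fun i => (shifted σ I i)⁻¹) * v) j j
      = ∑ i ∈ I, (shifted σ I i)⁻¹ * v i j ^ 2 := by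
    intro j
    rw [Matrix.mul_apply, ← Finset.sum_add_sum_compl I]
    simp only [diagOn, Matrix.mul_diagonal]
    rw [Finset.sum_eq_zero (s := Iᶜ), add_zero]
    · refine Finset.sum_congr rfl fun i hi => ?_
      rw [if_pos hi, hs.apply i j]; ring
    · intro i hi
      rw [if_neg (Finset.mem_compl.1 hi)]; ring
  have h2 : (vᵀ * v).trace = ∑ i ∈ I, ∑ k ∈ I, v i k ^ 2 + 2 * ∑ i ∈ I, ∑ j ∈ Iᶜ, v i j ^ 2 := by
    have h3 : (vᵀ * v).trace = ∑ i, ∑ k, v i k ^ 2 := by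
      simp only [Matrix.trace, Matrix.diag, Matrix.mul_apply, Matrix.transpose_apply]
      rw [Finset.sum_comm]
      exact Finset.sum_congr rfl fun i _ => Finset.sum_congr rfl fun k _ => (sq _).symm
    have h4 : ∑ i ∈ Iᶜ, ∑ k, v i k ^ 2 = ∑ i ∈ I, ∑ j ∈ Iᶜ, v i j ^ 2 := by
      rw [Finset.sum_comm' (t' := Finset.univ) (s' := fun _ => Iᶜ) (by simp),
        ← Finset.sum_add_sum_compl I, Finset.sum_eq_zero (s := Iᶜ), add_zero]
      · refine Finset.sum_congr rfl fun i _ => Finset.sum_congr rfl fun j _ => ?_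
        rw [hs.apply i j]
      · intro i hi
        refine Finset.sum_eq_zero fun j hj => ?_
        rw [hz j i (Finset.mem_compl.1 hj) (Finset.mem_compl.1 hi)]; simp
    rw [h3, ← Finset.sum_add_sum_compl I, h4]
    simp_rw [← Finset.sum_add_sum_compl I (fun k => v _ k ^ 2), Finset.sum_add_distrib]
    ring
  have h5 : ∑ j ∈ Iᶜ, -4 * shifted σ I j * ∑ i ∈ I, (shifted σ I i)⁻¹ * v i j ^ 2
      = ∑ i ∈ I, ∑ j ∈ Iᶜ, -4 * (shifted σ I j / shifted σ I i) * v i j ^ 2 := by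
    simp only [Finset.mul_sum]
    rw [Finset.sum_comm]
    refine Finset.sum_congr rfl fun i _ => Finset.sum_congr rfl fun j _ => ?_
    ring
  have h6 : ∑ i ∈ I, ∑ j ∈ Iᶜ, 4 * (1 - shifted σ I j / shifted σ I i) * v i j ^ 2
      = 4 * ∑ i ∈ I, ∑ j ∈ Iᶜ, v i j ^ 2
        + ∑ i ∈ I, ∑ j ∈ Iᶜ, -4 * (shifted σ I j / shifted σ I i) * v i j ^ 2 := by
    simp only [Finset.mul_sum, ← Finset.sum_add_distrib]
    refine Finset.sum_congr rfl fun i _ => Finset.sum_congr rfl fun j _ => ?_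
    ring
  simp only [lossForm, h1]
  rw [h5, h2, h6]
  ring

/-- The linear part of the loss sees only the complementary diagonal entries, which are of order
`t²`, so the limit depends on the velocity alone and not on the acceleration of the curve. -/
lemma tendsto_gaussianLoss_curve (hl : ∀ i ∈ I, shifted σ I i ≠ 0)
    {c : ℝ → Matrix (Fin n) (Fin n) ℝ} (h0 : c 0 = diagOn I (shifted σ I))
    (hc : ContDiffAt ℝ ∞ c 0) (hX : ∀ᶠ t in 𝓝 (0 : ℝ), c t ∈ symRank n I.card) :
    Tendsto (fun t => (gaussianLoss (Matrix.diagonal σ) (c t)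
        - gaussianLoss (Matrix.diagonal σ) (c 0)) / t ^ 2) (𝓝[≠] 0)
      (𝓝 (lossForm σ I (deriv c 0))) := by
  have hent := tendsto_matrix_entry_sub_div hc
  have h1 : Tendsto (fun t => ∑ j ∈ Iᶜ, -4 * shifted σ I j * (c t j j / t ^ 2)) (𝓝[≠] 0)
      (𝓝 (∑ j ∈ Iᶜ, -4 * shifted σ I j *
        (deriv c 0 * diagOn I (fun i => (shifted σ I i)⁻¹) * deriv c 0) j j)) :=
    tendsto_finsetSum _ fun j hj => (tendsto_complBlock_div_sq hl h0 hc hX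
      (Finset.mem_compl.1 hj) (Finset.mem_compl.1 hj)).const_mul _
  have h2 : Tendsto (fun t => 2 * ∑ j, ∑ i, (c t i j - c 0 i j) / t * ((c t i j - c 0 i j) / t)
      + (∑ i, (c t i i - c 0 i i) / t) ^ 2) (𝓝[≠] 0)
      (𝓝 (2 * ∑ j, ∑ i, deriv c 0 i j * deriv c 0 i j + (∑ i, deriv c 0 i i) ^ 2)) :=
    ((tendsto_finsetSum _ fun j _ => tendsto_finsetSum _ fun i _ =>
      (hent i j).mul (hent i j)).const_mul 2).add ((tendsto_finsetSum _ fun i _ => hent i i).pow 2)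
  refine (h1.add h2).congr fun t => ?_
  have h3 := gaussianLoss_add (Matrix.diagonal σ) (c 0) (c t - c 0)
  rw [add_sub_cancel] at h3
  have h4 : 4 * ((c 0 - Matrix.diagonal σ)ᵀ * (c t - c 0)).trace
      + 2 * (c 0 - Matrix.diagonal σ).trace * (c t - c 0).trace
      = ∑ j ∈ Iᶜ, -4 * shifted σ I j * c t j j := by
    rw [h0, linear_part_diagOn]
    refine Finset.sum_congr rfl fun j hj => ?_
    rw [Matrix.sub_apply, diagOn_apply_of_notMem (Finset.mem_compl.1 hj), sub_zero]
  rw [h3, h4, add_assoc, add_sub_cancel_left, add_div, Finset.sum_div]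
  congr 1
  · exact Finset.sum_congr rfl fun j _ => by rw [mul_div_assoc]
  · simp only [Matrix.trace, Matrix.diag, Matrix.mul_apply, Matrix.transpose_apply,
      Matrix.sub_apply, ← Finset.sum_div]
    rw [add_div, div_pow, mul_div_assoc, Finset.sum_div]
    congr 2
    refine Finset.sum_congr rfl fun j _ => ?_
    rw [Finset.sum_div]
    exact Finset.sum_congr rfl fun i _ => by rw [div_mul_div_comm, sq]

end Loss

/-! ### The index at the diagonal critical matrices -/

section Index

open Filter

variable {n : ℕ} {σ : Fin n → ℝ} {I : Finset (Fin n)} {d : ℕ}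
  {U : Set (EuclideanSpace ℝ (Fin d))} {p : EuclideanSpace ℝ (Fin d) → Matrix (Fin n) (Fin n) ℝ}

lemma IsLocalParam.contDiffAt {V : Type*} [NormedAddCommGroup V] [NormedSpace ℝ V] {X : Set V}
    {s : V} {p : EuclideanSpace ℝ (Fin d) → V} (h : IsLocalParam X s U p) :
    ContDiffAt ℝ ∞ p 0 :=
  h.contDiffOn.contDiffAt (h.isOpen.mem_nhds h.zero_mem)

/-- The image of a line through the origin under a local parametrization is a curve in `X`. -/
lemma IsLocalParam.curve {V : Type*} [NormedAddCommGroup V] [NormedSpace ℝ V] {X : Set V}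
    {s : V} {p : EuclideanSpace ℝ (Fin d) → V} (h : IsLocalParam X s U p)
    (u : EuclideanSpace ℝ (Fin d)) :
    ContDiffAt ℝ ∞ (fun t : ℝ => p (t • u)) 0 ∧ (∀ᶠ t in 𝓝 (0 : ℝ), p (t • u) ∈ X) ∧
      deriv (fun t : ℝ => p (t • u)) 0 = fderiv ℝ p 0 u := by
  have hp : ContDiffAt ℝ ∞ p ((0 : ℝ) • u) := by rw [zero_smul]; exact h.contDiffAt
  have hline : HasDerivAt (fun t : ℝ => t • u) u 0 := by
    simpa using (hasDerivAt_id (0 : ℝ)).smul_const u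
  refine ⟨hp.comp (0 : ℝ) (contDiff_id.smul contDiff_const).contDiffAt, ?_, ?_⟩
  · have hU : U ∈ 𝓝 ((0 : ℝ) • u) := by rw [zero_smul]; exact h.isOpen.mem_nhds h.zero_mem
    filter_upwards [hline.continuousAt.eventually hU] with t ht using h.mem ht
  · have h1 := (hp.differentiableAt (by simp)).hasFDerivAt.comp_hasDerivAt (0 : ℝ) hline
    rw [zero_smul] at h1
    exact h1.deriv

lemma fderiv_param_mem_borderedSpace (hl : ∀ i ∈ I, shifted σ I i ≠ 0)
    (h : IsLocalParam (symRank n I.card) (diagOn I (shifted σ I)) U p)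
    (u : EuclideanSpace ℝ (Fin d)) : fderiv ℝ p 0 u ∈ borderedSpace I := by
  obtain ⟨hc, hX, hd⟩ := h.curve u
  exact Eq.subst (motive := fun v => v ∈ borderedSpace I) hd
    (deriv_mem_borderedSpace hl (by rw [zero_smul, h.map_zero]) hc hX)

/-- Along `t ↦ p (t • u)` the same difference quotient has two limits: half the Hessian form, and
`lossForm` of the velocity. -/
lemma hessian_gaussianLoss_comp_param (hl : ∀ i ∈ I, shifted σ I i ≠ 0)
    (h : IsLocalParam (symRank n I.card) (diagOn I (shifted σ I)) U p)
    (u : EuclideanSpace ℝ (Fin d)) :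
    u.ofLp ⬝ᵥ hessianAtZero (gaussianLoss (Matrix.diagonal σ) ∘ p) *ᵥ u.ofLp
      = 2 * lossForm σ I (fderiv ℝ p 0 u) := by
  obtain ⟨hc, hX, hd⟩ := h.curve u
  have hg : ContDiffAt ℝ ∞ (gaussianLoss (Matrix.diagonal σ) ∘ p) 0 :=
    (contDiff_gaussianLoss _).contDiffAt.comp 0 h.contDiffAt
  have hcrit : fderiv ℝ (gaussianLoss (Matrix.diagonal σ) ∘ p) 0 u = 0 := by
    have h1 : HasFDerivAt (gaussianLoss (Matrix.diagonal σ))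
        (fderiv ℝ (gaussianLoss (Matrix.diagonal σ)) (p 0)) (p 0) :=
      ((contDiff_gaussianLoss _).differentiable (by simp) _).hasFDerivAt
    have h2 := (h1.comp 0 (h.contDiffAt.differentiableAt (by simp)).hasFDerivAt).fderiv
    rw [h2, h.map_zero]
    exact fderiv_gaussianLoss_diagOn (fderiv_param_mem_borderedSpace hl h u)
  have h1 := tendsto_second_order_of_fderiv_eq_zero (hg.of_le (by norm_cast)) hcrit
  have h2 := tendsto_gaussianLoss_curve hl (by rw [zero_smul, h.map_zero]) hc hX
  simp only [zero_smul] at h2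
  have h3 := (tendsto_nhds_unique h1 h2).trans (congrArg (lossForm σ I) hd)
  rw [dotProduct_hessianAtZero_mulVec]
  exact ((div_eq_iff two_ne_zero).1 h3).trans (mul_comm _ _)

/-- Both ends of `[0, 1]` are excluded: `0` because `shifted σ I i ≠ 0`, and `1` because the `σ` are
distinct. Inverting the quotient gives the sign condition on the coefficient in `lossForm_eq`. -/
lemma mem_indexPairs_iff (hσ : Function.Injective σ) {i j : Fin n} (hi : i ∈ I) (hj : j ∉ I)
    (hl : shifted σ I i ≠ 0) :
    (i, j) ∈ indexPairs σ I ↔ 1 < shifted σ I j / shifted σ I i := by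
  have hne : shifted σ I i ≠ shifted σ I j := by
    intro h
    exact hj (hσ (add_right_cancel h) ▸ hi)
  have hinv : shifted σ I j / shifted σ I i = (shifted σ I i / shifted σ I j)⁻¹ :=
    (inv_div _ _).symm
  change (i ∈ I ∧ j ∈ Iᶜ ∧ shifted σ I j ≠ 0 ∧ 0 ≤ shifted σ I i / shifted σ I j ∧
    shifted σ I i / shifted σ I j ≤ 1) ↔ _
  constructor
  · rintro ⟨-, -, h0, h1, h2⟩
    rw [hinv]
    refine (one_lt_inv₀ (lt_of_le_of_ne h1 (div_ne_zero hl h0).symm)).2 (lt_of_le_of_ne h2 ?_)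
    rwa [Ne, div_eq_one_iff_eq h0]
  · intro h
    have h0 : shifted σ I j ≠ 0 := by
      intro h0
      rw [h0, zero_div] at h
      exact absurd h (by norm_num)
    have hpos : 0 < shifted σ I i / shifted σ I j := by
      rw [← inv_pos, ← hinv]; linarith
    refine ⟨hi, Finset.mem_compl.2 hj, h0, hpos.le, ?_⟩
    rw [hinv, one_lt_inv₀ hpos] at h
    exact h.le

/-- The symmetric matrix with entries `w` at the index pairs and their transposes, and zeros
elsewhere. -/
def pairMatrix (σ : Fin n → ℝ) (I : Finset (Fin n)) :
    (indexPairs σ I → ℝ) →ₗ[ℝ] borderedSpace I := by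
  classical
  exact
  { toFun := fun w => ⟨Matrix.of fun a b =>
      (if h : (a, b) ∈ indexPairs σ I then w ⟨_, h⟩ else 0)
        + (if h : (b, a) ∈ indexPairs σ I then w ⟨_, h⟩ else 0), by
      refine mem_borderedSpace.2 ⟨Matrix.IsSymm.ext fun a b => add_comm _ _, fun a b ha hb => ?_⟩
      have h1 : (a, b) ∉ indexPairs σ I := fun h => ha h.1
      have h2 : (b, a) ∉ indexPairs σ I := fun h => hb h.1
      simp [h1, h2]⟩
    map_add' := by
      intro w z
      ext a b
      simp only [Submodule.coe_add, Matrix.add_apply, Matrix.of_apply, Pi.add_apply]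
      split_ifs <;> ring
    map_smul' := by
      intro c w
      ext a b
      simp only [Submodule.coe_smul, Matrix.smul_apply, Matrix.of_apply, Pi.smul_apply,
        RingHom.id_apply, smul_eq_mul]
      split_ifs <;> ring }

lemma pairMatrix_apply_of_mem (w : indexPairs σ I → ℝ) {a b : Fin n}
    (h : (a, b) ∈ indexPairs σ I) : (pairMatrix σ I w).1 a b = w ⟨_, h⟩ := by
  classical
  have h2 : (b, a) ∉ indexPairs σ I := fun h' => Finset.mem_compl.1 h.2.1 h'.1
  simp [pairMatrix, h, h2]

lemma pairMatrix_apply_of_notMem (w : indexPairs σ I → ℝ) {a b : Fin n}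
    (h : (a, b) ∉ indexPairs σ I) (h' : (b, a) ∉ indexPairs σ I) :
    (pairMatrix σ I w).1 a b = 0 := by
  classical
  simp [pairMatrix, h, h']

lemma lossForm_pairMatrix_neg (hσ : Function.Injective σ) (hl : ∀ i ∈ I, shifted σ I i ≠ 0)
    {w : indexPairs σ I → ℝ} (hw : w ≠ 0) : lossForm σ I (pairMatrix σ I w) < 0 := by
  have hI : ∀ a ∈ I, ∀ b ∈ I, (pairMatrix σ I w).1 a b = 0 := fun a ha b hb =>
    pairMatrix_apply_of_notMem w (fun h => Finset.mem_compl.1 h.2.1 hb)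
      (fun h => Finset.mem_compl.1 h.2.1 ha)
  have hdiag : ∀ a, (pairMatrix σ I w).1 a a = 0 := fun a =>
    pairMatrix_apply_of_notMem w (fun h => Finset.mem_compl.1 h.2.1 h.1)
      (fun h => Finset.mem_compl.1 h.2.1 h.1)
  have h1 : ∑ i ∈ I, ∑ k ∈ I, (pairMatrix σ I w).1 i k ^ 2 = 0 :=
    Finset.sum_eq_zero fun i hi => Finset.sum_eq_zero fun k hk => by rw [hI i hi k hk]; simp
  have h2 : (pairMatrix σ I w).1.trace = 0 := Finset.sum_eq_zero fun i _ => hdiag i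
  rw [lossForm_eq (pairMatrix σ I w).2, h1, h2]
  have hterm : ∀ i ∈ I, ∀ j ∈ Iᶜ, 4 * (1 - shifted σ I j / shifted σ I i) *
      (pairMatrix σ I w).1 i j ^ 2 ≤ 0 := by
    intro i hi j hj
    have hj := Finset.mem_compl.1 hj
    by_cases h : (i, j) ∈ indexPairs σ I
    · have := (mem_indexPairs_iff hσ hi hj (hl i hi)).1 h
      exact mul_nonpos_of_nonpos_of_nonneg (by linarith) (sq_nonneg _)
    · rw [pairMatrix_apply_of_notMem w h fun h' => hj h'.1]; simp
  obtain ⟨⟨⟨i, j⟩, hij⟩, hwij⟩ := Function.ne_iff.1 hw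
  have hij1 : i ∈ I := hij.1
  have hij2 : j ∈ Iᶜ := hij.2.1
  have hlt : ∑ i ∈ I, ∑ j ∈ Iᶜ, 4 * (1 - shifted σ I j / shifted σ I i) *
      (pairMatrix σ I w).1 i j ^ 2 < 0 := by
    refine Finset.sum_neg' (fun i hi => Finset.sum_nonpos (hterm i hi)) ⟨i, hij1, ?_⟩
    refine Finset.sum_neg' (hterm i hij1) ⟨j, hij2, ?_⟩
    have := (mem_indexPairs_iff hσ hij1 (Finset.mem_compl.1 hij2) (hl i hij1)).1 hij
    rw [pairMatrix_apply_of_mem w hij]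
    exact mul_neg_of_neg_of_pos (by linarith) (sq_pos_iff.2 hwij)
  linarith

lemma lossForm_nonneg (hσ : Function.Injective σ) (hl : ∀ i ∈ I, shifted σ I i ≠ 0)
    {v : Matrix (Fin n) (Fin n) ℝ} (hv : v ∈ borderedSpace I)
    (h : ∀ i j, (i, j) ∈ indexPairs σ I → v i j = 0) : 0 ≤ lossForm σ I v := by
  rw [lossForm_eq hv]
  refine add_nonneg (add_nonneg (mul_nonneg zero_le_two ?_) (sq_nonneg _)) ?_
  · exact Finset.sum_nonneg fun i _ => Finset.sum_nonneg fun k _ => sq_nonneg _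
  · refine Finset.sum_nonneg fun i hi => Finset.sum_nonneg fun j hj => ?_
    by_cases hij : (i, j) ∈ indexPairs σ I
    · rw [h i j hij]; simp
    · rw [mem_indexPairs_iff hσ hi (Finset.mem_compl.1 hj) (hl i hi), not_lt] at hij
      exact mul_nonneg (by linarith) (sq_nonneg _)

lemma hasIndexOn_diagOn (hσ : Function.Injective σ) (hl : ∀ i ∈ I, shifted σ I i ≠ 0) :
    HasIndexOn (gaussianLoss (Matrix.diagonal σ)) (symRank n I.card) (diagOn I (shifted σ I))
      (indexPairs σ I).ncard := by
  classical
  refine ⟨isSmoothPoint_diagOn hl, fun d U p h => ?_⟩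
  let D : EuclideanSpace ℝ (Fin d) →ₗ[ℝ] borderedSpace I :=
    (fderiv ℝ p 0).toLinearMap.codRestrict _ (fderiv_param_mem_borderedSpace hl h)
  have hDinj : Function.Injective D := fun a b hab =>
    h.immersion 0 h.zero_mem (congrArg Subtype.val hab)
  -- Injectivity bounds `d` above and the dimension bound bounds it below, so `D` is an isomorphism
  -- and negative directions can be pulled back to `ℝ^d`.
  have hfin : Module.finrank ℝ (EuclideanSpace ℝ (Fin d)) = Module.finrank ℝ (borderedSpace I) :=
    le_antisymm (LinearMap.finrank_le_finrank_of_injective hDinj)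
      (by rw [finrank_euclideanSpace_fin]; exact finrank_borderedSpace_le hl h)
  let De := LinearEquiv.ofInjectiveOfFinrankEq D hDinj hfin
  have hDe : ∀ E, fderiv ℝ p 0 (De.symm E) = E.1 := fun E =>
    congrArg Subtype.val (De.apply_symm_apply E)
  let f : EuclideanSpace ℝ (Fin d) →ₗ[ℝ] (indexPairs σ I → ℝ) :=
    { toFun := fun u q => (D u).1 q.1.1 q.1.2
      map_add' := fun u v => by ext q; simp
      map_smul' := fun c u => by ext q; simp }
  have hherm : (hessianAtZero (gaussianLoss (Matrix.diagonal σ) ∘ p)).IsHermitian :=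
    isHermitian_hessianAtZero (((contDiff_gaussianLoss _).contDiffAt.comp 0 h.contDiffAt).of_le
      (by norm_cast))
  rw [numNegEigenvalues_eq_of_forms hherm f (De.symm.toLinearMap ∘ₗ pairMatrix σ I),
    ← Nat.card_eq_fintype_card, Nat.card_coe_set_eq]
  · intro u hu
    rw [hessian_gaussianLoss_comp_param hl h]
    refine mul_nonneg zero_le_two (lossForm_nonneg hσ hl (D u).2 fun i j hij => ?_)
    exact congrFun hu ⟨(i, j), hij⟩
  · intro w hw
    rw [hessian_gaussianLoss_comp_param hl h]
    have := lossForm_pairMatrix_neg hσ hl hw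
    have h1 : fderiv ℝ p 0 ((De.symm.toLinearMap ∘ₗ pairMatrix σ I) w) = (pairMatrix σ I w).1 :=
      hDe _
    rw [h1]
    linarith

end Index

/-! ### The critical points -/

section Critical

open Filter

variable {n r : ℕ} {σ : Fin n → ℝ}

/-- Congruence by `1 + t • A`, invertible for small `t`, preserves symmetry and rank. -/
lemma congruence_mem_tangentVectors {S : Matrix (Fin n) (Fin n) ℝ} (hS : S ∈ symRank n r)
    (A : Matrix (Fin n) (Fin n) ℝ) : A * S + S * Aᵀ ∈ tangentVectors (symRank n r) S := by
  have hexp : ∀ t : ℝ, (1 + t • A) * S * (1 + t • A)ᵀ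
      = S + t • (A * S + S * Aᵀ) + t ^ 2 • (A * S * Aᵀ) := by
    intro t
    simp only [Matrix.transpose_add, Matrix.transpose_one, Matrix.transpose_smul, add_mul, mul_add,
      one_mul, mul_one, Matrix.smul_mul, Matrix.mul_smul, smul_add, smul_smul, sq]
    abel
  refine ⟨fun t => S + t • (A * S + S * Aᵀ) + t ^ 2 • (A * S * Aᵀ), by simp, ?_, ?_, ?_⟩
  · exact ((contDiff_const.add (contDiff_id.smul contDiff_const)).add
      ((contDiff_id.pow 2).smul contDiff_const)).contDiffAt
  · have hdet : ContinuousAt (fun t : ℝ => (1 + t • A).det) 0 :=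
      (ContDiffAt.matrix_det (contDiff_const.add
        (contDiff_id.smul contDiff_const)).contDiffAt).continuousAt
    have hne : (1 + (0 : ℝ) • A).det ≠ 0 := by simp
    filter_upwards [hdet.eventually_ne hne] with t ht
    rw [← hexp]
    refine ⟨?_, ?_⟩
    · rw [Matrix.IsSymm, Matrix.transpose_mul, Matrix.transpose_mul, hS.1.eq,
        Matrix.transpose_transpose, mul_assoc]
    · rw [Matrix.rank_mul_eq_left_of_det_ne_zero _ _ (by rwa [Matrix.det_transpose]),
        Matrix.rank_mul_eq_right_of_det_ne_zero _ _ ht, hS.2]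
  · have h1 := (((hasDerivAt_id (0 : ℝ)).smul_const (A * S + S * Aᵀ)).const_add S).add
      ((hasDerivAt_pow 2 (0 : ℝ)).smul_const (A * S * Aᵀ))
    exact (h1.congr_deriv (by simp)).deriv

/-- The normal equation `S (2 (S - T) + tr(S - T)) = 0` at a critical point. -/
lemma mul_gradient_eq_zero {T S : Matrix (Fin n) (Fin n) ℝ} (hT : T.IsSymm)
    (hS : S ∈ criticalPointsOn (gaussianLoss T) (symRank n r)) :
    S * ((2 : ℝ) • (S - T) + (S - T).trace • (1 : Matrix (Fin n) (Fin n) ℝ)) = 0 := by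
  obtain ⟨hmem, -, hcrit⟩ := hS
  set G := (2 : ℝ) • (S - T) + (S - T).trace • (1 : Matrix (Fin n) (Fin n) ℝ)
  have hST : (S - T)ᵀ = S - T := by rw [Matrix.transpose_sub, hmem.1.eq, hT.eq]
  have hG : Gᵀ = G := by simp only [G, Matrix.transpose_add, Matrix.transpose_smul, hST,
    Matrix.transpose_one]
  have hd : ∀ E, fderiv ℝ (gaussianLoss T) S E = 2 * (G * E).trace := by
    intro E
    rw [fderiv_gaussianLoss, hST]
    simp only [G, add_mul, Matrix.smul_mul, one_mul, Matrix.trace_add, Matrix.trace_smul,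
      smul_eq_mul]
    ring
  -- In this direction both summands of the tangent vector contribute equally, and the derivative is
  -- `4 ‖S * G‖²` in the Frobenius norm.
  have h1 := hcrit _ (congruence_mem_tangentVectors hmem (S * G)ᵀ)
  have h2 : (G * (S * (S * G)ᵀᵀ)).trace = (G * ((S * G)ᵀ * S)).trace := by
    rw [← Matrix.trace_transpose]
    simp only [Matrix.transpose_mul, hG, hmem.1.eq]
    rw [Matrix.trace_mul_comm]
  have h3 : (G * ((S * G)ᵀ * S)).trace = ((S * G) * (S * G)ᵀ).trace := by
    rw [← mul_assoc, Matrix.trace_mul_comm, mul_assoc]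
  have h4 : ((S * G) * (S * G)ᵀ).trace = 0 := by
    have h5 := (hd _).symm.trans h1
    rw [mul_add, Matrix.trace_add, h2, h3] at h5
    linarith
  rw [← Matrix.conjTranspose_eq_transpose_of_trivial] at h4
  exact Matrix.trace_mul_conjTranspose_self_eq_zero_iff.1 h4

lemma exists_diagOn_of_critical (hσ : Function.Injective σ) {S : Matrix (Fin n) (Fin n) ℝ}
    (hS : S ∈ criticalPointsOn (gaussianLoss (Matrix.diagonal σ)) (symRank n r)) :
    ∃ I ∈ admissibleSets σ r, diagOn I (shifted σ I) = S := by
  classical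
  have heq := mul_gradient_eq_zero (by simp [Matrix.IsSymm]) hS
  obtain ⟨⟨hsymm, hrank⟩, -, -⟩ := hS
  set τ := (S - Matrix.diagonal σ).trace with hτ
  have hSD : (2 : ℝ) • (S * Matrix.diagonal σ) = (2 : ℝ) • (S * S) + τ • S := by
    rw [mul_add, Matrix.mul_smul, Matrix.mul_smul, mul_sub, mul_one, smul_sub] at heq
    rw [← sub_eq_zero, ← neg_eq_zero, ← heq]
    abel
  have hDS : (2 : ℝ) • (Matrix.diagonal σ * S) = (2 : ℝ) • (S * S) + τ • S := by
    have := congrArg Matrix.transpose hSD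
    simpa [Matrix.transpose_mul, hsymm.eq] using this
  -- The two equations above make `S` commute with a diagonal matrix with distinct entries.
  have hoff : ∀ i j, i ≠ j → S i j = 0 := by
    intro i j hij
    have := congrFun (congrFun (hSD.trans hDS.symm) i) j
    simp only [Matrix.smul_apply, Matrix.mul_diagonal, Matrix.diagonal_mul, smul_eq_mul] at this
    have h1 : S i j * (σ j - σ i) = 0 := by linarith
    exact (mul_eq_zero.1 h1).resolve_right (sub_ne_zero.2 fun h => hij (hσ h).symm)
  have hSdiag : S = Matrix.diagonal fun i => S i i := by
    ext i j
    by_cases h : i = j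
    · subst h; simp
    · rw [hoff i j h, Matrix.diagonal_apply_ne _ h]
  have hroot : ∀ i, S i i ≠ 0 → S i i = σ i - τ / 2 := by
    intro i hi
    have := congrFun (congrFun hSD i) i
    rw [Matrix.add_apply, Matrix.smul_apply, Matrix.smul_apply, Matrix.smul_apply,
      Matrix.mul_diagonal] at this
    nth_rewrite 2 [hSdiag] at this
    rw [Matrix.diagonal_mul] at this
    simp only [smul_eq_mul] at this
    have h1 : S i i * (S i i - (σ i - τ / 2)) = 0 := by linarith
    exact sub_eq_zero.1 ((mul_eq_zero.1 h1).resolve_left hi)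
  set I : Finset (Fin n) := Finset.univ.filter fun i => S i i ≠ 0
  have hI : ∀ i, i ∈ I ↔ S i i ≠ 0 := fun i => by simp [I]
  have hcard : I.card = r := by
    rw [← hrank, hSdiag, Matrix.rank_diagonal, Fintype.card_subtype]
  -- Self-consistency: `τ` is itself the trace of the matrix whose entries it determines. Solving
  -- for `-(τ / 2)` gives `eigShift σ I`.
  have htr : τ = -(I.card : ℝ) * (τ / 2) - ∑ j ∈ Iᶜ, σ j := by
    conv_lhs => rw [hτ]
    simp only [Matrix.trace, Matrix.diag, Matrix.sub_apply, Matrix.diagonal_apply_eq]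
    rw [← Finset.sum_add_sum_compl I, Finset.sum_congr rfl (g := fun _ => -(τ / 2)),
      Finset.sum_congr rfl (s₁ := Iᶜ) (g := fun j => - σ j)]
    · rw [Finset.sum_const, nsmul_eq_mul, Finset.sum_neg_distrib]; ring
    · intro j hj
      have : S j j = 0 := not_not.1 fun h => Finset.mem_compl.1 hj ((hI j).2 h)
      rw [this, zero_sub]
    · intro i hi
      rw [hroot i ((hI i).1 hi)]; ring
  have hshift : eigShift σ I = -(τ / 2) := by
    have h2 : (I.card : ℝ) + 2 ≠ 0 :=
      (add_pos_of_nonneg_of_pos (Nat.cast_nonneg _) two_pos).ne'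
    rw [eigShift, div_eq_iff h2]
    linarith
  have hval : ∀ i ∈ I, shifted σ I i = S i i := by
    intro i hi
    rw [shifted, hshift, hroot i ((hI i).1 hi)]; ring
  refine ⟨I, ⟨hcard, fun i hi => ?_⟩, ?_⟩
  · change shifted σ I i ≠ 0
    rw [hval i hi]; exact (hI i).1 hi
  · rw [hSdiag, diagOn]
    congr 1
    ext i
    split_ifs with hi
    · exact hval i hi
    · exact (not_not.1 fun h => hi ((hI i).2 h)).symm

lemma diagOn_mem_criticalPointsOn {I : Finset (Fin n)} (hI : I ∈ admissibleSets σ r) :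
    diagOn I (shifted σ I) ∈ criticalPointsOn (gaussianLoss (Matrix.diagonal σ)) (symRank n r) := by
  obtain ⟨rfl, hl⟩ := hI
  refine ⟨diagOn_mem_symRank hl, isSmoothPoint_diagOn hl, ?_⟩
  rintro v ⟨c, h0, hc, hX, rfl⟩
  exact fderiv_gaussianLoss_diagOn (deriv_mem_borderedSpace hl h0 hc hX)

/-- Admissibility makes `I` exactly the support of the diagonal. -/
lemma injOn_diagOn_shifted :
    Set.InjOn (fun I => diagOn I (shifted σ I)) (admissibleSets σ r) := by
  have key : ∀ I ∈ admissibleSets σ r, ∀ i, i ∈ I ↔ diagOn I (shifted σ I) i i ≠ 0 := by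
    intro I hI i
    by_cases hi : i ∈ I
    · have : shifted σ I i ≠ 0 := hI.2 i hi
      simpa [diagOn, hi] using this
    · simp [diagOn, hi]
  intro I hI J hJ hIJ
  ext i
  rw [key I hI, key J hJ]
  exact iff_of_eq (congrArg (fun S : Matrix (Fin n) (Fin n) ℝ => S i i ≠ 0) hIJ)

end Critical

/-! ### Orthogonal conjugation -/

section Conjugation

variable {n : ℕ} {U : Matrix (Fin n) (Fin n) ℝ}

lemma transpose_mul_self_of_orthogonal (hU : U ∈ Matrix.orthogonalGroup (Fin n) ℝ) :
    Uᵀ * U = 1 :=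
  (Matrix.mem_orthogonalGroup_iff' (Fin n) ℝ).1 hU

lemma mul_transpose_self_of_orthogonal (hU : U ∈ Matrix.orthogonalGroup (Fin n) ℝ) :
    U * Uᵀ = 1 :=
  (Matrix.mem_orthogonalGroup_iff (Fin n) ℝ).1 hU

/-- Conjugation `S ↦ U S Uᵀ` by an orthogonal matrix. -/
def orthConj (hU : U ∈ Matrix.orthogonalGroup (Fin n) ℝ) :
    Matrix (Fin n) (Fin n) ℝ ≃L[ℝ] Matrix (Fin n) (Fin n) ℝ :=
  LinearEquiv.toContinuousLinearEquiv
    { toFun := fun S => U * S * Uᵀ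
      invFun := fun S => Uᵀ * S * U
      map_add' := fun S S' => by rw [mul_add, add_mul]
      map_smul' := fun c S => by simp
      left_inv := fun S => by
        simp only [← mul_assoc, transpose_mul_self_of_orthogonal hU, one_mul]
        rw [mul_assoc, transpose_mul_self_of_orthogonal hU, mul_one]
      right_inv := fun S => by
        simp only [← mul_assoc, mul_transpose_self_of_orthogonal hU, one_mul]
        rw [mul_assoc, mul_transpose_self_of_orthogonal hU, mul_one] }

lemma orthConj_apply (hU : U ∈ Matrix.orthogonalGroup (Fin n) ℝ)
    (S : Matrix (Fin n) (Fin n) ℝ) : orthConj hU S = U * S * Uᵀ := rfl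

lemma orthConj_mem_symRank (hU : U ∈ Matrix.orthogonalGroup (Fin n) ℝ) {r : ℕ}
    (S : Matrix (Fin n) (Fin n) ℝ) : orthConj hU S ∈ symRank n r ↔ S ∈ symRank n r := by
  have hdet : U.det ≠ 0 := fun h => by
    have := congrArg Matrix.det (mul_transpose_self_of_orthogonal hU)
    simp [h] at this
  have h1 : (U * S * Uᵀ).rank = S.rank := by
    rw [Matrix.rank_mul_eq_left_of_det_ne_zero _ _ (by rwa [Matrix.det_transpose]),
      Matrix.rank_mul_eq_right_of_det_ne_zero _ _ hdet]
  have h2 : (orthConj hU S)ᵀ = orthConj hU Sᵀ := by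
    simp only [orthConj_apply, Matrix.transpose_mul, Matrix.transpose_transpose, mul_assoc]
  have h3 : (orthConj hU S).IsSymm ↔ S.IsSymm := by
    rw [Matrix.IsSymm, h2, (orthConj hU).injective.eq_iff, Matrix.IsSymm]
  change (orthConj hU S).IsSymm ∧ (U * S * Uᵀ).rank = r ↔ S.IsSymm ∧ S.rank = r
  rw [h1, h3]

lemma gaussianLoss_orthConj (hU : U ∈ Matrix.orthogonalGroup (Fin n) ℝ)
    (T S : Matrix (Fin n) (Fin n) ℝ) :
    gaussianLoss (orthConj hU T) (orthConj hU S) = gaussianLoss T S := by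
  have h1 : ∀ A, (U * A * Uᵀ).trace = A.trace := fun A => by
    rw [Matrix.trace_mul_comm, ← mul_assoc, transpose_mul_self_of_orthogonal hU, one_mul]
  have h2 : ∀ A, (U * A * Uᵀ)ᵀ * (U * A * Uᵀ) = U * (Aᵀ * A) * Uᵀ := fun A => by
    calc (U * A * Uᵀ)ᵀ * (U * A * Uᵀ) = U * Aᵀ * (Uᵀ * U) * A * Uᵀ := by
          simp only [Matrix.transpose_mul, Matrix.transpose_transpose, mul_assoc]
      _ = _ := by rw [transpose_mul_self_of_orthogonal hU, mul_one, mul_assoc U]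
  rw [gaussianLoss, ← map_sub, orthConj_apply, h1, h2, h1, gaussianLoss]

end Conjugation

end

theorem theorem4p6 (n r : ℕ) (T U : Matrix (Fin n) (Fin n) ℝ) (σ : Fin n → ℝ)
    (hrank : T.rank = n)
    (hU : U ∈ Matrix.orthogonalGroup (Fin n) ℝ)
    (hσ : Function.Injective σ)
    (hT : T = U * Matrix.diagonal σ * Uᵀ) :
    criticalPointsOn (gaussianLoss T) (symRank n r) = critMatrix U σ '' admissibleSets σ r ∧
    Set.InjOn (critMatrix U σ) (admissibleSets σ r) ∧
    ((∀ I : Finset (Fin n), I.card = r → ∀ i ∈ I, σ i + eigShift σ I ≠ 0) →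
      (criticalPointsOn (gaussianLoss T) (symRank n r)).ncard = n.choose r) ∧
    ∀ I ∈ admissibleSets σ r,
      HasIndexOn (gaussianLoss T) (symRank n r) (critMatrix U σ I) (indexPairs σ I).ncard := by
  have hloss : ∀ S, gaussianLoss T (orthConj hU S) = gaussianLoss (Matrix.diagonal σ) S := by
    intro S
    rw [hT]
    exact gaussianLoss_orthConj hU (Matrix.diagonal σ) S
  have hX : ∀ S, orthConj hU S ∈ symRank n r ↔ S ∈ symRank n r := orthConj_mem_symRank hU
  -- `critMatrix U σ I` unfolds to `orthConj hU (diagOn I (shifted σ I))`, so results for the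
  -- diagonal case transfer by definitional equality.
  have hinj : Set.InjOn (critMatrix U σ) (admissibleSets σ r) :=
    (orthConj hU).injective.comp_injOn injOn_diagOn_shifted
  have hcrit : criticalPointsOn (gaussianLoss T) (symRank n r)
      = critMatrix U σ '' admissibleSets σ r := by
    refine (criticalPointsOn_eq_image hX hloss).trans (Subset.antisymm ?_ ?_)
    · rintro _ ⟨S, hS, rfl⟩
      obtain ⟨I, hI, hIS⟩ := exists_diagOn_of_critical hσ hS
      exact ⟨I, hI, congrArg (orthConj hU) hIS⟩
    · rintro _ ⟨I, hI, rfl⟩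
      exact ⟨_, diagOn_mem_criticalPointsOn hI, rfl⟩
  refine ⟨hcrit, hinj, fun hall => ?_, ?_⟩
  · have hadm : admissibleSets σ r = ↑(Finset.univ.powersetCard r : Finset (Finset (Fin n))) := by
      ext I
      simp only [Finset.mem_coe, Finset.mem_powersetCard, Finset.subset_univ, true_and]
      exact ⟨fun h => h.1, fun h => ⟨h, hall I h⟩⟩
    rw [hcrit, hinj.ncard_image, hadm, Set.ncard_coe_finset, Finset.card_powersetCard,
      Finset.card_univ, Fintype.card_fin]
  · intro I hI
    have hidx := hasIndexOn_diagOn hσ hI.2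
    rw [hI.1] at hidx
    exact hidx.map hX hloss
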